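/- **Setting.** Let $X$ and $A$ be finite sets, $A\neq\emptyset$, let $\mathcal P(X),\mathcal P(A)$ be the sets of probability measures on them, $\|\mu-\nu\|_{TV}=\frac12\sum_x|\mu(x)-\nu(x)|$, and let $0<\beta<1$. Let $\mu_0\in\mathcal P(X)$, $c:X\times A\times\mathcal P(X)\to\mathbb R$, $p:X\times A\times\mathcal P(X)\to\mathcal P(X)$, and suppose that with constants $L_1,K_1\ge 0$, $\beta K_1/2<1$, for all arguments, $$|c(x,a,\mu)-c(\hat x,\hat a,\hat\mu)|\le L_1\big(1_{x\ne\hat x}+2\cdot 1_{a\neq\hat a}+2\|\mu-\hat\mu\|_{TV}\big),$$ $$\|p(\cdot|x,a,\mu)-p(\cdot|\hat x,\hat a,\hat\mu)\|_{TV}\le \tfrac{K_1}{2}\big(1_{x\ne\hat x}+2\cdot 1_{a\neq\hat a}+2\|\mu-\hat\mu\|_{TV}\big).$$ Let $\Omega:\mathcal P(A)\to\mathbb R$ be continuous and $\rho$-strongly convex for the $\ell^1$-norm, $\rho>0$; that is, for $u,v\in\mathcal P(A)$ and $s\in[0,1]$, $\Omega(su+(1-s)v)\le s\Omega(u)+(1-s)\Omega(v)-\frac{\rho}{2}s(1-s)\|u-v\|_1^2$.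 Put $C(x,u,\mu)=\sum_a c(x,a,\mu)u(a)$ and $P(\cdot|x,u,\mu)=\sum_a p(\cdot|x,a,\mu)u(a)$ for $u\in\mathcal P(A)$. A (Markov) policy is a sequence $\pmb\pi=(\pi_t)$ of maps $\pi_t:X\to\mathcal P(\mathcal P(A))$. For a flow $\pmb\mu=(\mu_t)$ in $\mathcal P(X)$ and a policy $\pmb\pi$, a player starts from $x_0\sim\mu_0$, chooses $a_t\sim\pi_t(\cdot|x_t)$ and moves to $x_{t+1}\sim P(\cdot|x_t,a_t,\mu_t)$. The pair $(\pmb\pi,\pmb\mu)$, where $\pmb\mu$ starts from the given $\mu_0$, is a non-stationary mean-field equilibrium ($\mathrm{MFE}_{\mathrm{ns}}$) if $\pmb\pi$ minimizes $E\big[\sum_{t=0}^\infty\beta^t(C(x_t,a_t,\mu_t)+\Omega(a_t))\big]$ over all policies and $\mu_{t+1}=\sum_x\mu_t(x)\int P(\cdot|x,u,\mu_t)\,\pi_t(du|x)$ for all $t\ge 0$. It is a finite-horizon equilibrium ($\mathrm{MFE}_T$) if the same holds with $\sum_{t=0}^{T}$ in the objective and with the evolution equation for $0\le t<T$. Write $$\bar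 L=\frac{L_1}{1-\beta K_1/2},\qquad \bar K=\frac{3K_1}{2}+\frac{K_1\bar L}{2\rho(1-\beta)},\qquad \hat K=\bar K+\frac{K_1\bar L}{\rho},$$ and let $\rho(A_T)$ be the spectral radius of the $T\times T$ matrix $A_T$ with entries, for $1\le i,j\le T$: $\frac{L_1K_1}{\rho}\beta^{T-i+1}$ if $j=T$; $\frac{\bar LK_1}{\rho}\beta^{j-i+1}$ if $i\le j<T$; $\hat K$ if $i=j+1$; and $0$ if $i>j+1$. **Theorem.** Suppose that $0<\epsilon<1$ satisfies $$\frac{\sqrt{\hat K}}{\sqrt{\hat K}+\sqrt{\hat K-\bar K}}>\beta^{1-\epsilon}$$ (in particular $\hat K>0$), and that $\sqrt{\hat K\beta}+\sqrt{(\hat K-\bar K)\beta}<1$. 1. There are constants $M'$ and $T_0$, depending only on the game and on $L_1,K_1,\rho,\epsilon$, such that for every $T\ge T_0$ with $\hat K\cos^2\big(\frac{\pi}{T+1}\big)-\bar K>0$, every $\mathrm{MFE}_{\mathrm{ns}}$ $(\pmb\pi,\pmb\mu)$, every $\mathrm{MFE}_T$ $(\pmb\pi^T,\pmb\mu^T)$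 and every $1\le t\le T$, $$\|\mu_t-\mu_t^T\|_{TV}\le M'\,\frac1t\left(\sqrt{\frac{\hat K}{\rho(A_T)\beta}}\right)^t(2T+1)\,\beta^{T\epsilon}.$$ 2. The infinite-horizon non-stationary MFE exists and is unique: for any two $\mathrm{MFE}_{\mathrm{ns}}$ $(\pmb\pi,\pmb\mu)$ and $(\pmb\pi',\pmb\mu')$ we have $\pmb\mu=\pmb\mu'$, and $\pi_t(\cdot|x)=\pi'_t(\cdot|x)$ for all $t$ and all $x$ with $\mu_t(x)>0$. Moreover, there is exactly one $\mathrm{MFE}_{\mathrm{ns}}$ whose policy is, given its flow, optimal for the infinite-horizon problem started at any time in any state. -/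

import Mathlib

open MeasureTheory

/-- `P(X)` for a finite set `X`, as the standard simplex. -/
abbrev PDist (X : Type*) [Fintype X] : Type _ := stdSimplex ℝ X

/-- Total variation distance on `P(X)`: one half of the `ℓ¹` distance. -/
noncomputable def tvDist {X : Type*} [Fintype X] (μ ν : PDist X) : ℝ :=
  (1 / 2) * ∑ x, |μ x - ν x|

/-- The data of a regularized discounted mean-field game with finite state set `X` and finite
action set `A`.  The players' action space is `P(A)`; only the values of `reg` on the simplex
matter. -/
structure RegMFG (X A : Type*) [Fintype X] [Fintype A] where
  /-- one-stage cost `c(x, a, μ)` -/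
  cost : X → A → PDist X → ℝ
  /-- transition probability `p(· | x, a, μ)` -/
  kernel : X → A → PDist X → PDist X
  /-- the regularizer `Ω` -/
  reg : (A → ℝ) → ℝ
  /-- the discount factor `β` -/
  disc : ℝ
  /-- the initial state measure `μ₀` -/
  init : PDist X

/-- A flow of state measures `(μ_t)_t`. -/
abbrev MFlow (X : Type*) [Fintype X] : Type _ := ℕ → PDist X

/-- A Markov policy for the action space `P(A)`: for each time `t` and state `x` a Borel
probability measure `π_t(· | x)` on `P(A)`. -/
abbrev Policy (X A : Type*) [Fintype A] : Type _ :=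
  ℕ → X → ProbabilityMeasure (PDist A)

/-- `Ω` is `ρ`-strongly convex on `P(A)` for the `ℓ¹` norm. -/
def StronglyConvexL1 {A : Type*} [Fintype A] (Ω : (A → ℝ) → ℝ) (ρ : ℝ) : Prop :=
  StrongConvexOn {u : PiLp 1 (fun _ : A => ℝ) | u.ofLp ∈ stdSimplex ℝ A} ρ (fun u => Ω u.ofLp)

namespace RegMFG

variable {X A : Type*} [Fintype X] [Fintype A]

open Classical in
/-- `|c(x,a,μ) - c(x',a',μ')| ≤ L₁ (1_{x ≠ x'} + 2 · 1_{a ≠ a'} + 2 ‖μ - μ'‖_TV)`. -/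
def CostLipschitz (G : RegMFG X A) (L₁ : ℝ) : Prop :=
  ∀ (x x' : X) (a a' : A) (μ μ' : PDist X),
    |G.cost x a μ - G.cost x' a' μ'| ≤
      L₁ * ((if x ≠ x' then 1 else 0) + 2 * (if a ≠ a' then 1 else 0) + 2 * tvDist μ μ')

open Classical in
/-- `‖p(·|x,a,μ) - p(·|x',a',μ')‖_TV ≤ (K₁/2) (1_{x ≠ x'} + 2 · 1_{a ≠ a'} + 2 ‖μ - μ'‖_TV)`. -/
def KernelLipschitz (G : RegMFG X A) (K₁ : ℝ) : Prop :=
  ∀ (x x' : X) (a a' : A) (μ μ' : PDist X),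
    tvDist (G.kernel x a μ) (G.kernel x' a' μ') ≤
      K₁ / 2 * ((if x ≠ x' then 1 else 0) + 2 * (if a ≠ a' then 1 else 0) + 2 * tvDist μ μ')

/-- The regularized cost `C(x,u,μ) + Ω(u)`, with `C(x,u,μ) = ∑ₐ c(x,a,μ) u(a)`. -/
noncomputable def regCost (G : RegMFG X A) (x : X) (u : PDist A) (μ : PDist X) : ℝ :=
  ∑ a, G.cost x a μ * u a + G.reg u

/-- `P(y | x,u,μ) = ∑ₐ p(y | x,a,μ) u(a)`. -/
noncomputable def trans (G : RegMFG X A) (x : X) (u : PDist A) (μ : PDist X) (y : X) : ℝ :=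
  ∑ a, G.kernel x a μ y * u a

/-- One step of the state law: `y ↦ ∑ₓ m(x) ∫ P(y | x,u,μ) q(du | x)`. -/
noncomputable def nextLaw (G : RegMFG X A) (μ : PDist X) (q : X → ProbabilityMeasure (PDist A))
    (m : X → ℝ) : X → ℝ :=
  fun y => ∑ x, m x * ∫ u, G.trans x u μ y ∂(q x : Measure (PDist A))

/-- The law of the state `x_t` of a player who starts from the law `m` and uses the policy `π`
while the population follows the flow `μ`. -/
noncomputable def stateLaw (G : RegMFG X A) (μ : MFlow X) (m : X → ℝ) (π : Policy X A) :
    ℕ → X → ℝ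
  | 0 => m
  | t + 1 => G.nextLaw (μ t) (π t) (stateLaw G μ m π t)

/-- `E^π [ C(x_t,a_t,μ_t) + Ω(a_t) ]` for the same player. -/
noncomputable def expCost (G : RegMFG X A) (μ : MFlow X) (m : X → ℝ) (π : Policy X A)
    (t : ℕ) : ℝ :=
  ∑ x, G.stateLaw μ m π t x * ∫ u, G.regCost x u (μ t) ∂(π t x : Measure (PDist A))

/-- The discounted objective with horizon `T` (stages `0, …, T`). -/
noncomputable def objT (G : RegMFG X A) (T : ℕ) (μ : MFlow X) (m : X → ℝ) (π : Policy X A) : ℝ :=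
  ∑ t ∈ Finset.range (T + 1), G.disc ^ t * G.expCost μ m π t

/-- The discounted objective with infinite horizon. -/
noncomputable def objInf (G : RegMFG X A) (μ : MFlow X) (m : X → ℝ) (π : Policy X A) : ℝ :=
  ∑' t, G.disc ^ t * G.expCost μ m π t

/-- `(π, μ)` is a mean-field equilibrium of the game with horizon `T`.  Only `π_t`, `μ_t` with
`t ≤ T` enter; the values at later times are irrelevant. -/
structure IsMFE_T (G : RegMFG X A) (T : ℕ) (π : Policy X A) (μ : MFlow X) : Prop where
  init_eq : μ 0 = G.init
  evol : ∀ t < T, ∀ y, μ (t + 1) y = G.nextLaw (μ t) (π t) (μ t) y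
  optimal : ∀ π' : Policy X A, G.objT T μ G.init π ≤ G.objT T μ G.init π'

/-- `(π, μ)` is a non-stationary mean-field equilibrium of the infinite-horizon game. -/
structure IsMFE_ns (G : RegMFG X A) (π : Policy X A) (μ : MFlow X) : Prop where
  init_eq : μ 0 = G.init
  evol : ∀ t, ∀ y, μ (t + 1) y = G.nextLaw (μ t) (π t) (μ t) y
  optimal : ∀ π' : Policy X A, G.objInf μ G.init π ≤ G.objInf μ G.init π'

open Classical in
/-- Given the flow `μ`, the policy `π` is optimal for the infinite-horizon problem started at any
time `s` in any state `x`. -/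
def OptimalFromEverywhere (G : RegMFG X A) (π : Policy X A) (μ : MFlow X) : Prop :=
  ∀ (s : ℕ) (x : X) (π' : Policy X A),
    G.objInf (fun t => μ (s + t)) (Pi.single x 1) (fun t => π (s + t)) ≤
      G.objInf (fun t => μ (s + t)) (Pi.single x 1) π'

end RegMFG

/-- `L̄ = L₁ / (1 - β K₁ / 2)`. -/
noncomputable def Lbar (L₁ K₁ β : ℝ) : ℝ := L₁ / (1 - β * K₁ / 2)

/-- `K̄ = 3 K₁ / 2 + K₁ L̄ / (2 ρ (1 - β))`. -/
noncomputable def Kbar (L₁ K₁ β ρ : ℝ) : ℝ :=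
  3 * K₁ / 2 + K₁ * Lbar L₁ K₁ β / (2 * ρ * (1 - β))

/-- `K̂ = K̄ + K₁ L̄ / ρ`. -/
noncomputable def Khat (L₁ K₁ β ρ : ℝ) : ℝ :=
  Kbar L₁ K₁ β ρ + K₁ / ρ * Lbar L₁ K₁ β

/-- The `T × T` matrix `A_T`; rows and columns are numbered from `0`. -/
noncomputable def matA (L₁ K₁ β ρ : ℝ) (T : ℕ) : Matrix (Fin T) (Fin T) ℝ :=
  Matrix.of fun i j =>
    if (j : ℕ) + 1 = T then L₁ * K₁ / ρ * β ^ ((j : ℕ) + 1 - (i : ℕ))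
    else if i ≤ j then Lbar L₁ K₁ β * K₁ / ρ * β ^ ((j : ℕ) + 1 - (i : ℕ))
    else if (i : ℕ) = (j : ℕ) + 1 then Kbar L₁ K₁ β ρ + Lbar L₁ K₁ β * K₁ / ρ
    else 0

/-- The spectral radius `ρ(A_T)`: the largest modulus of a complex eigenvalue. -/
noncomputable def specRadA (L₁ K₁ β ρ : ℝ) (T : ℕ) : ℝ :=
  (spectralRadius ℂ ((matA L₁ K₁ β ρ T).map ((↑) : ℝ → ℂ))).toReal

/-! Strong convexity of `Ω` makes every one-step problem uniquely solvable, with a minimizer that is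
Lipschitz in the linear coefficients. Dynamic programming then removes the policies. By the
performance difference formula `sum_expCost_eq`, the cost of a policy exceeds the optimal value by a
discounted sum of nonnegative gaps. An optimal policy therefore plays the unique best response at
every state it visits, and an equilibrium flow is exactly a solution of `μ (t+1) = nextBest (μ t) (V
(t+1))`, with `V` the value of that flow. This recursion looks forward through `μ` and backward
through `V`.

Flows are compared in the weighted distance `sup_t ‖μ_t - ν_t‖_TV / x^t`. The forward Lipschitz
constant `K̂` costs a factor `K̂ / x`; the influence of later times through the values sums a
geometric series to `(K̂ - K̄)β / (1 - βx)`. Their sum is `rate`. If `x ≥ 1`, `βx < 1` and `rate <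
1`, the weighted distance of any two flows is finite and the equilibrium map contracts, which gives
existence and uniqueness.

A finite horizon only perturbs the terminal value. The same estimate, applied at the time where the
weighted distance is largest, gives `‖μ_t - μ_t^T‖_TV ≤ C x^t / x^T` (`tvDist_isMFE_le`).

At the weight minimizing `rate`, the minimum is `β(√K̂ + √(K̂ - K̄))²` and `x² = K̂ / (β · rate)`.
The vector of powers of `x` is a positive test vector for `A_T` and shows `ρ(A_T) ≤ rate`, hence `x
≤ √(K̂ / (ρ(A_T) β))`. The assumption with `ε` says that `β^ε x` is at least `1`, hence `x^(-T) ≤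
β^(Tε)`. The factor `(2T+1)/t` is slack. -/

/-! ### Total variation distance and mixtures. -/

section TotalVariation

variable {X I : Type*} [Fintype X] [Fintype I]

lemma tvDist_nonneg (μ ν : PDist X) : 0 ≤ tvDist μ ν := by
  unfold tvDist
  have := Finset.sum_nonneg fun x (_ : x ∈ Finset.univ) => abs_nonneg (μ x - ν x)
  linarith

lemma tvDist_self (μ : PDist X) : tvDist μ μ = 0 := by simp [tvDist]

lemma tvDist_comm (μ ν : PDist X) : tvDist μ ν = tvDist ν μ := by
  simp [tvDist, abs_sub_comm]

lemma tvDist_triangle (μ ν τ : PDist X) : tvDist μ τ ≤ tvDist μ ν + tvDist ν τ := by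
  unfold tvDist
  have : ∑ x, |μ x - τ x| ≤ ∑ x, (|μ x - ν x| + |ν x - τ x|) :=
    Finset.sum_le_sum fun x _ => abs_sub_le _ _ _
  rw [Finset.sum_add_distrib] at this
  linarith

lemma sum_abs_sub_eq (μ ν : PDist X) : ∑ x, |μ x - ν x| = 2 * tvDist μ ν := by
  unfold tvDist; ring

lemma tvDist_le_one (μ ν : PDist X) : tvDist μ ν ≤ 1 := by
  have : ∑ x, |μ x - ν x| ≤ ∑ x, (μ x + ν x) := Finset.sum_le_sum fun x _ => by
    have h1 := stdSimplex.zero_le μ x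
    have h2 := stdSimplex.zero_le ν x
    rw [abs_le]; constructor <;> linarith
  rw [Finset.sum_add_distrib, stdSimplex.sum_eq_one, stdSimplex.sum_eq_one] at this
  unfold tvDist
  linarith

lemma continuous_tvDist : Continuous fun p : PDist X × PDist X => tvDist p.1 p.2 := by
  unfold tvDist
  refine continuous_const.mul (continuous_finsetSum _ fun x _ => ?_)
  exact (((continuous_apply x).comp (continuous_subtype_val.comp continuous_fst)).sub
    ((continuous_apply x).comp (continuous_subtype_val.comp continuous_snd))).abs

lemma dist_le_two_mul_tvDist (μ ν : PDist X) : dist μ ν ≤ 2 * tvDist μ ν := by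
  rw [Subtype.dist_eq, dist_pi_le_iff (by have := tvDist_nonneg μ ν; positivity)]
  intro x
  rw [← sum_abs_sub_eq, Real.dist_eq]
  exact Finset.single_le_sum (f := fun x => |μ x - ν x|) (fun _ _ => abs_nonneg _)
    (Finset.mem_univ x)

lemma eq_of_tvDist_le_zero {μ ν : PDist X} (h : tvDist μ ν ≤ 0) : μ = ν := by
  have h1 := dist_le_two_mul_tvDist μ ν
  exact dist_le_zero.1 (by linarith)

/-- A function of oscillation at most `κ` integrates against `μ - ν` to at most `κ ‖μ - ν‖_TV`. -/
lemma abs_sum_mul_sub_le {g : X → ℝ} {κ : ℝ} (hg : ∀ x y, g x - g y ≤ κ) (μ ν : PDist X) :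
    |∑ x, g x * (μ x - ν x)| ≤ κ * tvDist μ ν := by
  rcases isEmpty_or_nonempty X with h | h
  · simp [tvDist]
  obtain ⟨i, hi⟩ := Finite.exists_max g
  obtain ⟨j, hj⟩ := Finite.exists_min g
  -- Since `μ - ν` has mass zero, `g` may be recentred at its midrange, which leaves a sup norm of
  -- at most `κ / 2`.
  have h0 : ∑ x, (μ x - ν x) = 0 := by
    rw [Finset.sum_sub_distrib, stdSimplex.sum_eq_one, stdSimplex.sum_eq_one, sub_self]
  have h1 : ∑ x, g x * (μ x - ν x) = ∑ x, (g x - (g i + g j) / 2) * (μ x - ν x) := by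
    simp only [sub_mul _ _ (μ _ - ν _), Finset.sum_sub_distrib (f := fun x => g x * _)]
    rw [← Finset.mul_sum, h0]; ring
  rw [h1]
  calc _ ≤ ∑ x, |(g x - (g i + g j) / 2) * (μ x - ν x)| := Finset.abs_sum_le_sum_abs _ _
    _ ≤ ∑ x, κ / 2 * |μ x - ν x| := Finset.sum_le_sum fun x _ => by
        rw [abs_mul]
        refine mul_le_mul_of_nonneg_right ?_ (abs_nonneg _)
        have := hi x; have := hj x; have := hg i j
        rw [abs_le]; constructor <;> linarith
    _ = κ * tvDist μ ν := by rw [← Finset.mul_sum, sum_abs_sub_eq]; ring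

/-- The mixture `∑ i, u i • k i`. -/
noncomputable def mix (k : I → PDist X) (u : PDist I) : PDist X :=
  ⟨fun y => ∑ i, k i y * u i,
    fun y => Finset.sum_nonneg fun i _ =>
      mul_nonneg (stdSimplex.zero_le (k i) y) (stdSimplex.zero_le u i), by
    rw [Finset.sum_comm]
    simp only [← Finset.sum_mul, stdSimplex.sum_eq_one, one_mul]⟩

lemma mix_apply (k : I → PDist X) (u : PDist I) (y : X) : mix k u y = ∑ i, k i y * u i := rfl

lemma tvDist_mix_left {k k' : I → PDist X} {u : PDist I} {c : ℝ}
    (h : ∀ i, tvDist (k i) (k' i) ≤ c) : tvDist (mix k u) (mix k' u) ≤ c := by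
  have h1 : ∑ y, |mix k u y - mix k' u y| ≤ 2 * c := by
    calc _ ≤ ∑ y, ∑ i, |k i y - k' i y| * u i := Finset.sum_le_sum fun y _ => by
          rw [mix_apply, mix_apply, ← Finset.sum_sub_distrib]
          refine (Finset.abs_sum_le_sum_abs _ _).trans (le_of_eq ?_)
          refine Finset.sum_congr rfl fun i _ => ?_
          rw [← sub_mul, abs_mul, abs_of_nonneg (stdSimplex.zero_le u i)]
      _ = ∑ i, 2 * tvDist (k i) (k' i) * u i := by
          rw [Finset.sum_comm]
          simp only [← Finset.sum_mul, sum_abs_sub_eq]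
      _ ≤ ∑ i, 2 * c * u i := Finset.sum_le_sum fun i _ => by
          refine mul_le_mul_of_nonneg_right ?_ (stdSimplex.zero_le u i)
          linarith [h i]
      _ = 2 * c := by rw [← Finset.mul_sum, stdSimplex.sum_eq_one, mul_one]
  rw [sum_abs_sub_eq] at h1
  linarith

/-- Duality: testing against the sign of the difference turns the `ℓ¹` norm into the pairing of `u -
v` with a function of oscillation at most `2κ`. -/
lemma tvDist_mix_right {k : I → PDist X} {κ : ℝ} (h : ∀ i j, tvDist (k i) (k j) ≤ κ)
    (u v : PDist I) : tvDist (mix k u) (mix k v) ≤ κ * tvDist u v := by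
  set f : X → ℝ := fun y => SignType.sign (mix k u y - mix k v y) with hf
  have hfb : ∀ y, |f y| ≤ 1 := fun y => by
    rcases lt_trichotomy (mix k u y - mix k v y) 0 with h | h | h <;> simp [hf, h]
  have h1 : ∑ y, |mix k u y - mix k v y| = ∑ i, (∑ y, f y * k i y) * (u i - v i) := by
    simp only [Finset.sum_mul]
    rw [Finset.sum_comm]
    refine Finset.sum_congr rfl fun y _ => ?_
    rw [← sign_mul_self (mix k u y - mix k v y)]
    change f y * _ = _
    rw [mix_apply, mix_apply, ← Finset.sum_sub_distrib, Finset.mul_sum]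
    exact Finset.sum_congr rfl fun i _ => by ring
  have h2 : |∑ i, (∑ y, f y * k i y) * (u i - v i)| ≤ 2 * κ * tvDist u v := by
    refine abs_sum_mul_sub_le (fun i j => ?_) u v
    rw [← Finset.sum_sub_distrib]
    calc _ ≤ ∑ y, |k i y - k j y| := Finset.sum_le_sum fun y _ => by
          rw [← mul_sub]
          refine (le_abs_self _).trans ?_
          rw [abs_mul]
          exact mul_le_of_le_one_left (abs_nonneg _) (hfb y)
      _ ≤ 2 * κ := by rw [sum_abs_sub_eq]; linarith [h i j]
  rw [← h1, sum_abs_sub_eq] at h2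
  have := (le_abs_self _).trans h2
  linarith

end TotalVariation

/-! ### Strongly convex minimization on the simplex. -/

section Minimizer

variable {A : Type*} [Fintype A]

/-- The regularized linear functional `⟨q, u⟩ + Ω(u)`. -/
noncomputable def regLin (Ω : (A → ℝ) → ℝ) (q : A → ℝ) (u : PDist A) : ℝ :=
  ∑ a, q a * u a + Ω u

lemma continuous_reg {Ω : (A → ℝ) → ℝ} (hΩ : ContinuousOn Ω (stdSimplex ℝ A)) :
    Continuous fun u : PDist A => Ω u :=
  continuousOn_iff_continuous_domRestrict.1 hΩ

lemma continuous_coord (a : A) : Continuous fun u : PDist A => u a :=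
  (continuous_apply a).comp continuous_subtype_val

lemma continuous_regLin {Ω : (A → ℝ) → ℝ} (hΩ : ContinuousOn Ω (stdSimplex ℝ A)) (q : A → ℝ) :
    Continuous (regLin Ω q) :=
  (continuous_finsetSum _ fun a _ => continuous_const.mul (continuous_coord a)).add
    (continuous_reg hΩ)

lemma exists_minimizer [Nonempty A] {Ω : (A → ℝ) → ℝ} (hΩ : ContinuousOn Ω (stdSimplex ℝ A))
    (q : A → ℝ) : ∃ u, ∀ v, regLin Ω q u ≤ regLin Ω q v := by
  obtain ⟨u, -, hu⟩ := isCompact_univ.exists_isMinOn (Set.univ_nonempty (α := PDist A))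
    (continuous_regLin hΩ q).continuousOn
  exact ⟨u, fun v => hu (Set.mem_univ v)⟩

/-- Strong convexity in terms of the total variation distance, `‖u - v‖₁ = 2 ‖u - v‖_TV`. -/
lemma StronglyConvexL1.le {Ω : (A → ℝ) → ℝ} {ρ : ℝ} (h : StronglyConvexL1 Ω ρ) (u v w : PDist A)
    {s : ℝ} (hs₀ : 0 ≤ s) (hs₁ : s ≤ 1) (hw : ∀ a, w a = s * u a + (1 - s) * v a) :
    Ω w ≤ s * Ω u + (1 - s) * Ω v - ρ / 2 * s * (1 - s) * (2 * tvDist u v) ^ 2 := by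
  have h1 := h.2 (x := WithLp.toLp 1 (u : A → ℝ)) u.2 (y := WithLp.toLp 1 (v : A → ℝ)) v.2
    hs₀ (sub_nonneg.2 hs₁) (by ring)
  have h2 : ‖WithLp.toLp 1 (u : A → ℝ) - WithLp.toLp 1 (v : A → ℝ)‖ = 2 * tvDist u v := by
    rw [← sum_abs_sub_eq, PiLp.norm_eq_sum (by simp)]
    simp
  have h3 : (s • WithLp.toLp 1 (u : A → ℝ) + (1 - s) • WithLp.toLp 1 (v : A → ℝ)).ofLp = w := by
    ext a; simp [hw]
  simp only [h2, h3, smul_eq_mul] at h1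
  linarith

/-- Minimality is tested at `s v + (1 - s) u`, divided by `s`, and `s → 0`; the limit keeps the full
constant `ρ / 2`. -/
lemma quadratic_growth {Ω : (A → ℝ) → ℝ} {ρ : ℝ} (h : StronglyConvexL1 Ω ρ) {q : A → ℝ}
    {u : PDist A} (hu : ∀ v, regLin Ω q u ≤ regLin Ω q v) (v : PDist A) :
    regLin Ω q u + ρ / 2 * (2 * tvDist v u) ^ 2 ≤ regLin Ω q v := by
  set D := ρ / 2 * (2 * tvDist v u) ^ 2
  have key : ∀ s : ℝ, 0 < s → s ≤ 1 → (1 - s) * D ≤ regLin Ω q v - regLin Ω q u := by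
    intro s hs hs1
    obtain ⟨w, hw⟩ : ∃ w : PDist A, ∀ a, w a = s * v a + (1 - s) * u a :=
      ⟨⟨_, convex_stdSimplex ℝ A v.2 u.2 hs.le (sub_nonneg.2 hs1) (by ring)⟩, fun a => rfl⟩
    have h1 := h.le v u w hs.le hs1 hw
    have h2 := hu w
    have h3 : ∑ a, q a * w a = s * ∑ a, q a * v a + (1 - s) * ∑ a, q a * u a := by
      rw [Finset.mul_sum, Finset.mul_sum, ← Finset.sum_add_distrib]
      exact Finset.sum_congr rfl fun a _ => by rw [hw]; ring
    have h4 : s * ((1 - s) * D) ≤ s * (regLin Ω q v - regLin Ω q u) := by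
      simp only [regLin, h3, D] at h2 ⊢
      linarith
    exact le_of_mul_le_mul_left h4 hs
  have hlim : Filter.Tendsto (fun s : ℝ => (1 - s) * D) (nhdsWithin 0 (Set.Ioi 0)) (nhds D) := by
    have : Filter.Tendsto (fun s : ℝ => (1 - s) * D) (nhds 0) (nhds ((1 - 0) * D)) :=
      Continuous.tendsto (by fun_prop) 0
    simp only [sub_zero, one_mul] at this
    exact this.mono_left nhdsWithin_le_nhds
  have := le_of_tendsto hlim (Filter.eventually_of_mem (Ioc_mem_nhdsGT one_pos)
    fun s hs => key s hs.1 hs.2)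
  linarith

lemma abs_regLin_sub_le {Ω : (A → ℝ) → ℝ} {q q' : A → ℝ} {δ : ℝ} (hδ : ∀ a, |q a - q' a| ≤ δ)
    (u : PDist A) : |regLin Ω q u - regLin Ω q' u| ≤ δ := by
  have : regLin Ω q u - regLin Ω q' u = ∑ a, (q a - q' a) * u a := by
    simp only [regLin, sub_mul, Finset.sum_sub_distrib]; ring
  rw [this]
  calc _ ≤ ∑ a, |(q a - q' a) * u a| := Finset.abs_sum_le_sum_abs _ _
    _ ≤ ∑ a, δ * u a := Finset.sum_le_sum fun a _ => by
        rw [abs_mul, abs_of_nonneg (stdSimplex.zero_le u a)]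
        exact mul_le_mul_of_nonneg_right (hδ a) (stdSimplex.zero_le u a)
    _ = δ := by rw [← Finset.mul_sum, stdSimplex.sum_eq_one, mul_one]

lemma abs_min_sub_min_le {Ω : (A → ℝ) → ℝ} {q q' : A → ℝ} {δ : ℝ} (hδ : ∀ a, |q a - q' a| ≤ δ)
    {u u' : PDist A} (hu : ∀ v, regLin Ω q u ≤ regLin Ω q v)
    (hu' : ∀ v, regLin Ω q' u' ≤ regLin Ω q' v) : |regLin Ω q u - regLin Ω q' u'| ≤ δ := by
  have h1 := abs_le.1 (abs_regLin_sub_le (Ω := Ω) hδ u)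
  have h2 := abs_le.1 (abs_regLin_sub_le (Ω := Ω) hδ u')
  have h3 := hu u'
  have h4 := hu' u
  rw [abs_le]; constructor <;> linarith

/-- Adding the growth inequalities at the two minimizers cancels `Ω`. What remains is `4ρ d² ≤ 2δ d`
for `d = ‖u - u'‖_TV`, because `q - q'` has oscillation at most `2δ`. -/
lemma tvDist_minimizer_le {Ω : (A → ℝ) → ℝ} {ρ : ℝ} (h : StronglyConvexL1 Ω ρ) (hρ : 0 < ρ)
    {q q' : A → ℝ} {δ : ℝ} (hδ : ∀ a, |q a - q' a| ≤ δ)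
    {u u' : PDist A} (hu : ∀ v, regLin Ω q u ≤ regLin Ω q v)
    (hu' : ∀ v, regLin Ω q' u' ≤ regLin Ω q' v) : tvDist u u' ≤ δ / (2 * ρ) := by
  have h1 := quadratic_growth h hu u'
  have h2 := quadratic_growth h hu' u
  have h3 : |∑ a, (q a - q' a) * (u' a - u a)| ≤ 2 * δ * tvDist u' u := by
    refine abs_sum_mul_sub_le (fun a b => ?_) u' u
    have h1 := abs_le.1 (hδ a); have h2 := abs_le.1 (hδ b); linarith
  have h4 : ∑ a, (q a - q' a) * (u' a - u a) =
      (regLin Ω q u' - regLin Ω q' u') - (regLin Ω q u - regLin Ω q' u) := by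
    simp only [regLin, sub_mul, mul_sub, Finset.sum_sub_distrib]; ring
  rw [h4] at h3
  rw [tvDist_comm u' u] at *
  have h5 := (le_abs_self _).trans h3
  have h6 : 4 * ρ * tvDist u u' ^ 2 ≤ 2 * δ * tvDist u u' := by linarith
  -- When `d = 0` the claim is `δ ≥ 0`, which needs a point of `A`; the simplex over an empty set
  -- has no element `u`.
  rcases (tvDist_nonneg u u').eq_or_lt with h0 | h0
  · rw [← h0]
    rcases isEmpty_or_nonempty A with hA | ⟨⟨a⟩⟩
    · have := u.2.2; simp at this
    · have := (abs_nonneg _).trans (hδ a); positivity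
  · rw [le_div_iff₀ (by positivity)]
    nlinarith

end Minimizer

/-! ### Relations between the constants. -/

section Constants

variable {L₁ K₁ β ρ : ℝ}

/-- `L̄` is the fixed point of `l ↦ L₁ + (βK₁/2) l`, the recursion that the Bellman operator imposes
on the oscillation of values. -/
lemma Lbar_eq (h : β * K₁ / 2 < 1) : L₁ + β * K₁ / 2 * Lbar L₁ K₁ β = Lbar L₁ K₁ β := by
  have : 1 - β * K₁ / 2 ≠ 0 := by linarith
  unfold Lbar
  generalize β * K₁ / 2 = z at *
  field_simp
  ring

lemma Lbar_nonneg (hL : 0 ≤ L₁) (h : β * K₁ / 2 < 1) : 0 ≤ Lbar L₁ K₁ β :=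
  div_nonneg hL (by linarith)

/-- The left side is the constant that the one-step estimate produces; `K̂` is larger by the factor
`1 / (1 - β)` in one term. -/
lemma le_Khat (hβ₀ : 0 ≤ β) (hβ₁ : β < 1) (hL : 0 ≤ Lbar L₁ K₁ β) (hK : 0 ≤ K₁) (hρ : 0 < ρ) :
    3 * K₁ / 2 + K₁ * Lbar L₁ K₁ β / (2 * ρ) + K₁ / ρ * Lbar L₁ K₁ β ≤ Khat L₁ K₁ β ρ := by
  have h1 : K₁ * Lbar L₁ K₁ β / (2 * ρ) ≤ K₁ * Lbar L₁ K₁ β / (2 * ρ * (1 - β)) := by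
    refine div_le_div_of_nonneg_left (mul_nonneg hK hL) (mul_pos (by linarith) (by linarith)) ?_
    exact mul_le_of_le_one_right (by linarith) (by linarith)
  unfold Khat Kbar
  linarith

lemma Khat_sub_Kbar : Khat L₁ K₁ β ρ - Kbar L₁ K₁ β ρ = K₁ / ρ * Lbar L₁ K₁ β := by
  unfold Khat; ring

end Constants

/-! ### One-step estimates: Bellman operator, best response, population update. -/

namespace RegMFG

variable {X A : Type*} [Fintype X] [Fintype A] {G : RegMFG X A}

/-- The standing assumptions on the data of the game. -/
structure Regular (G : RegMFG X A) (L₁ K₁ ρ : ℝ) : Prop where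
  disc_pos : 0 < G.disc
  disc_lt_one : G.disc < 1
  L_nonneg : 0 ≤ L₁
  K_nonneg : 0 ≤ K₁
  disc_mul_lt : G.disc * K₁ / 2 < 1
  cost_lip : G.CostLipschitz L₁
  kernel_lip : G.KernelLipschitz K₁
  rho_pos : 0 < ρ
  strong : StronglyConvexL1 G.reg ρ
  cont : ContinuousOn G.reg (stdSimplex ℝ A)

/-- The coefficients of the linear part of the one-step problem with continuation value `W`. -/
noncomputable def qFun (G : RegMFG X A) (x : X) (μ : PDist X) (W : X → ℝ) (a : A) : ℝ :=
  G.cost x a μ + G.disc * ∑ y, W y * G.kernel x a μ y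

/-- `P(· | x, u, μ)` as an element of the simplex. -/
noncomputable def transDist (G : RegMFG X A) (x : X) (u : PDist A) (μ : PDist X) : PDist X :=
  mix (fun a => G.kernel x a μ) u

lemma transDist_apply (x : X) (u : PDist A) (μ : PDist X) (y : X) :
    G.transDist x u μ y = G.trans x u μ y := rfl

lemma regLin_qFun (x : X) (μ : PDist X) (W : X → ℝ) (u : PDist A) :
    regLin G.reg (G.qFun x μ W) u =
      G.regCost x u μ + G.disc * ∑ y, W y * G.trans x u μ y := by
  have : ∑ a, (∑ y, W y * G.kernel x a μ y) * u a = ∑ y, W y * G.trans x u μ y := by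
    simp only [trans, Finset.sum_mul, Finset.mul_sum]
    rw [Finset.sum_comm]
    simp only [mul_assoc]
  rw [← this]
  simp only [regLin, qFun, regCost, add_mul, Finset.sum_add_distrib, mul_assoc, ← Finset.mul_sum]
  ring

variable {L₁ K₁ ρ : ℝ}

lemma cost_sub_le_of_state (h : G.Regular L₁ K₁ ρ) (x x' : X) (a : A) (μ : PDist X) :
    |G.cost x a μ - G.cost x' a μ| ≤ L₁ := by
  have := h.cost_lip x x' a a μ μ
  have hL := h.L_nonneg
  simp only [tvDist_self] at this
  split_ifs at this <;> simp_all

lemma cost_sub_le_of_flow (h : G.Regular L₁ K₁ ρ) (x : X) (a : A) (μ μ' : PDist X) :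
    |G.cost x a μ - G.cost x a μ'| ≤ L₁ * (2 * tvDist μ μ') := by
  have := h.cost_lip x x a a μ μ'
  simpa using this

lemma kernel_tvDist_le_of_state (h : G.Regular L₁ K₁ ρ) (x x' : X) (a : A) (μ : PDist X) :
    tvDist (G.kernel x a μ) (G.kernel x' a μ) ≤ K₁ / 2 := by
  have := h.kernel_lip x x' a a μ μ
  have hK := h.K_nonneg
  simp only [tvDist_self] at this
  rw [if_neg (not_not.2 rfl)] at this
  split_ifs at this <;> linarith

lemma kernel_tvDist_le_of_action (h : G.Regular L₁ K₁ ρ) (x : X) (a a' : A) (μ : PDist X) :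
    tvDist (G.kernel x a μ) (G.kernel x a' μ) ≤ K₁ := by
  have := h.kernel_lip x x a a' μ μ
  have hK := h.K_nonneg
  rw [tvDist_self, if_neg (not_not.2 rfl)] at this
  split_ifs at this <;> linarith

lemma kernel_tvDist_le_of_flow (h : G.Regular L₁ K₁ ρ) (x : X) (a : A) (μ μ' : PDist X) :
    tvDist (G.kernel x a μ) (G.kernel x a μ') ≤ K₁ * tvDist μ μ' := by
  have := h.kernel_lip x x a a μ μ'
  simp only [ne_eq, not_true_eq_false, if_false] at this
  linarith

/-- A bound for the one-stage costs. -/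
lemma exists_abs_regCost_le (h : G.Regular L₁ K₁ ρ) :
    ∃ B : ℝ, 0 ≤ B ∧ ∀ x u μ, |G.regCost x u μ| ≤ B := by
  obtain ⟨B₁, hB₁⟩ := (isCompact_univ (X := PDist A)).exists_bound_of_continuousOn
    (continuous_reg h.cont).continuousOn
  obtain ⟨B₂, hB₂⟩ := (Set.finite_range fun p : X × A => |G.cost p.1 p.2 G.init|).bddAbove
  have hL := h.L_nonneg
  have key : ∀ x u μ, |G.regCost x u μ| ≤ B₂ + L₁ * 2 + B₁ := by
    intro x u μ
    have hc : ∀ a, |G.cost x a μ| ≤ B₂ + L₁ * 2 := fun a => by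
      have h1 := h.cost_lip x x a a μ G.init
      simp only [ne_eq, not_true_eq_false, if_false, mul_zero, zero_add] at h1
      have h2 : |G.cost x a G.init| ≤ B₂ := hB₂ ⟨(x, a), rfl⟩
      have h3 := tvDist_le_one μ G.init
      have h4 : L₁ * (2 * tvDist μ G.init) ≤ L₁ * 2 :=
        mul_le_mul_of_nonneg_left (by linarith) hL
      have h5 := abs_sub_abs_le_abs_sub (G.cost x a μ) (G.cost x a G.init)
      linarith
    have h1 := abs_regLin_sub_le (Ω := 0) (q := fun a => G.cost x a μ) (q' := 0)
      (by simpa using hc) u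
    have h2 := hB₁ u (Set.mem_univ u)
    simp only [regLin, Pi.zero_apply, zero_mul, Finset.sum_const_zero, add_zero, sub_zero] at h1
    rw [Real.norm_eq_abs] at h2
    exact (abs_add_le _ _).trans (add_le_add h1 h2)
  exact ⟨|B₂ + L₁ * 2 + B₁|, abs_nonneg _, fun x u μ => (key x u μ).trans (le_abs_self _)⟩

lemma abs_sum_mul_le {W : X → ℝ} {D : ℝ} (hW : ∀ y, |W y| ≤ D) (m : PDist X) :
    |∑ y, W y * m y| ≤ D := by
  have := abs_regLin_sub_le (Ω := 0) (q := W) (q' := 0) (by simpa using hW) m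
  simpa [regLin] using this

lemma qFun_sub_le_of_state (h : G.Regular L₁ K₁ ρ) {W : X → ℝ} {l : ℝ}
    (hW : ∀ y z, W y - W z ≤ l) (x x' : X) (μ : PDist X) (a : A) :
    |G.qFun x μ W a - G.qFun x' μ W a| ≤ L₁ + G.disc * K₁ / 2 * l := by
  have h1 := cost_sub_le_of_state h x x' a μ
  have h2 := abs_sum_mul_sub_le hW (G.kernel x a μ) (G.kernel x' a μ)
  have h3 := kernel_tvDist_le_of_state h x x' a μ
  have hl : 0 ≤ l := by simpa using hW x x
  have h4 : G.qFun x μ W a - G.qFun x' μ W a = (G.cost x a μ - G.cost x' a μ) +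
      G.disc * ∑ y, W y * (G.kernel x a μ y - G.kernel x' a μ y) := by
    simp only [qFun, mul_sub, Finset.sum_sub_distrib]; ring
  rw [h4]
  refine (abs_add_le _ _).trans ?_
  rw [abs_mul, abs_of_pos h.disc_pos]
  have h5 : G.disc * |∑ y, W y * (G.kernel x a μ y - G.kernel x' a μ y)| ≤
      G.disc * (l * (K₁ / 2)) :=
    mul_le_mul_of_nonneg_left (h2.trans (mul_le_mul_of_nonneg_left h3 hl)) h.disc_pos.le
  linarith

lemma qFun_sub_le_of_flow (h : G.Regular L₁ K₁ ρ) {W W' : X → ℝ} {D : ℝ}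
    (hW : ∀ y z, W' y - W' z ≤ Lbar L₁ K₁ G.disc) (hD : ∀ y, |W y - W' y| ≤ D)
    (x : X) (μ μ' : PDist X) (a : A) :
    |G.qFun x μ W a - G.qFun x μ' W' a| ≤
      2 * Lbar L₁ K₁ G.disc * tvDist μ μ' + G.disc * D := by
  set l := Lbar L₁ K₁ G.disc with hl
  have h0 : L₁ + G.disc * K₁ / 2 * l = l := Lbar_eq h.disc_mul_lt
  have hl0 : 0 ≤ l := Lbar_nonneg h.L_nonneg h.disc_mul_lt
  have h1 := cost_sub_le_of_flow h x a μ μ'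
  have h2 := abs_sum_mul_sub_le hW (G.kernel x a μ) (G.kernel x a μ')
  have h3 := kernel_tvDist_le_of_flow h x a μ μ'
  have h4 : G.qFun x μ W a - G.qFun x μ' W' a = (G.cost x a μ - G.cost x a μ') +
      G.disc * (∑ y, W' y * (G.kernel x a μ y - G.kernel x a μ' y) +
        ∑ y, (W y - W' y) * G.kernel x a μ y) := by
    simp only [qFun, mul_sub, sub_mul, Finset.sum_sub_distrib]; ring
  have h5 := abs_sum_mul_le hD (G.kernel x a μ)
  rw [h4]
  refine (abs_add_le _ _).trans ?_
  rw [abs_mul, abs_of_pos h.disc_pos]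
  have h6 : G.disc * |∑ y, W' y * (G.kernel x a μ y - G.kernel x a μ' y) +
        ∑ y, (W y - W' y) * G.kernel x a μ y| ≤ G.disc * (l * (K₁ * tvDist μ μ') + D) :=
    mul_le_mul_of_nonneg_left ((abs_add_le _ _).trans
      (add_le_add (h2.trans (mul_le_mul_of_nonneg_left h3 hl0)) h5)) h.disc_pos.le
  calc _ ≤ L₁ * (2 * tvDist μ μ') + G.disc * (l * (K₁ * tvDist μ μ') + D) := add_le_add h1 h6
    -- The cost and kernel contributions combine to `2 L̄` by the fixed-point equation of `L̄`.
    _ = 2 * (L₁ + G.disc * K₁ / 2 * l) * tvDist μ μ' + G.disc * D := by ring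
    _ = _ := by rw [h0]

section BestResponse

variable [Nonempty A]

/-- The minimizer of the one-step problem with continuation value `W`. -/
noncomputable def bestResp (G : RegMFG X A) (x : X) (μ : PDist X) (W : X → ℝ) : PDist A :=
  Classical.epsilon fun u => ∀ v, regLin G.reg (G.qFun x μ W) u ≤ regLin G.reg (G.qFun x μ W) v

/-- The Bellman operator. -/
noncomputable def bellman (G : RegMFG X A) (μ : PDist X) (W : X → ℝ) (x : X) : ℝ :=
  regLin G.reg (G.qFun x μ W) (G.bestResp x μ W)

/-- The next state law if all players follow `bestResp`. -/
noncomputable def nextBest (G : RegMFG X A) (μ : PDist X) (W : X → ℝ) : PDist X :=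
  mix (fun x => G.transDist x (G.bestResp x μ W) μ) μ

lemma bellman_le (h : G.Regular L₁ K₁ ρ) (μ : PDist X) (W : X → ℝ) (x : X) (u : PDist A) :
    G.bellman μ W x ≤ regLin G.reg (G.qFun x μ W) u :=
  Classical.epsilon_spec (exists_minimizer h.cont (G.qFun x μ W)) u

lemma bellman_sub_le (h : G.Regular L₁ K₁ ρ) {W : X → ℝ} {l : ℝ}
    (hW : ∀ y z, W y - W z ≤ l) (μ : PDist X) (x x' : X) :
    G.bellman μ W x - G.bellman μ W x' ≤ L₁ + G.disc * K₁ / 2 * l :=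
  (le_abs_self _).trans (abs_min_sub_min_le (qFun_sub_le_of_state h hW x x' μ)
    (bellman_le h μ W x) (bellman_le h μ W x'))

lemma abs_bellman_sub_le (h : G.Regular L₁ K₁ ρ) {W W' : X → ℝ} {D : ℝ}
    (hW : ∀ y z, W' y - W' z ≤ Lbar L₁ K₁ G.disc) (hD : ∀ y, |W y - W' y| ≤ D)
    (μ μ' : PDist X) (x : X) :
    |G.bellman μ W x - G.bellman μ' W' x| ≤
      2 * Lbar L₁ K₁ G.disc * tvDist μ μ' + G.disc * D :=
  abs_min_sub_min_le (qFun_sub_le_of_flow h hW hD x μ μ') (bellman_le h μ W x)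
    (bellman_le h μ' W' x)

/-- The Bellman operator is a `β`-contraction. -/
lemma abs_bellman_sub_le_disc (h : G.Regular L₁ K₁ ρ) {W W' : X → ℝ} {D : ℝ}
    (hD : ∀ y, |W y - W' y| ≤ D) (μ : PDist X) (x : X) :
    |G.bellman μ W x - G.bellman μ W' x| ≤ G.disc * D := by
  refine abs_min_sub_min_le (fun a => ?_) (bellman_le h μ W x) (bellman_le h μ W' x)
  have h4 : G.qFun x μ W a - G.qFun x μ W' a = G.disc * ∑ y, (W y - W' y) * G.kernel x a μ y := by
    simp only [qFun, sub_mul, Finset.sum_sub_distrib]; ring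
  rw [h4, abs_mul, abs_of_pos h.disc_pos]
  exact mul_le_mul_of_nonneg_left (abs_sum_mul_le hD _) h.disc_pos.le

lemma abs_bellman_zero_le {B : ℝ} (hB : ∀ x u μ, |G.regCost x u μ| ≤ B) (μ : PDist X) (x : X) :
    |G.bellman μ 0 x| ≤ B := by
  rw [bellman, regLin_qFun]
  simpa using hB x _ μ

/-- The one-step stability estimate for the population dynamics. -/
lemma tvDist_nextBest_le (h : G.Regular L₁ K₁ ρ) {W W' : X → ℝ} {D : ℝ}
    (hW : ∀ y z, W y - W z ≤ Lbar L₁ K₁ G.disc)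
    (hW' : ∀ y z, W' y - W' z ≤ Lbar L₁ K₁ G.disc) (hD : ∀ y, |W y - W' y| ≤ D)
    (μ μ' : PDist X) :
    tvDist (G.nextBest μ W) (G.nextBest μ' W') ≤
      Khat L₁ K₁ G.disc ρ * tvDist μ μ' + K₁ / (2 * ρ) * (G.disc * D) := by
  set l := Lbar L₁ K₁ G.disc with hl
  have hρ := h.rho_pos
  have hK := h.K_nonneg
  have h0 : L₁ + G.disc * K₁ / 2 * l = l := Lbar_eq h.disc_mul_lt
  have hl0 : 0 ≤ l := Lbar_nonneg h.L_nonneg h.disc_mul_lt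
  -- Only the mixing measure changes here, so the cost is the dependence of kernel and best response
  -- on the state.
  have h1 : tvDist (G.nextBest μ W) (mix (fun x => G.transDist x (G.bestResp x μ W) μ) μ') ≤
      (K₁ / 2 + K₁ * (l / (2 * ρ))) * tvDist μ μ' := by
    refine tvDist_mix_right (fun x x' => ?_) μ μ'
    have h2 : tvDist (G.bestResp x μ W) (G.bestResp x' μ W) ≤ l / (2 * ρ) :=
      tvDist_minimizer_le h.strong hρ
        (fun a => (qFun_sub_le_of_state h hW x x' μ a).trans_eq h0)
        (bellman_le h μ W x) (bellman_le h μ W x')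
    refine (tvDist_triangle _ (G.transDist x' (G.bestResp x μ W) μ) _).trans (add_le_add ?_ ?_)
    · exact tvDist_mix_left fun a => kernel_tvDist_le_of_state h x x' a μ
    · exact (tvDist_mix_right (fun a a' => kernel_tvDist_le_of_action h x' a a' μ) _ _).trans
        (mul_le_mul_of_nonneg_left h2 hK)
  -- Now the mixing measure is fixed, while the flow argument and the continuation value change.
  have h2 : tvDist (mix (fun x => G.transDist x (G.bestResp x μ W) μ) μ') (G.nextBest μ' W') ≤
      K₁ * tvDist μ μ' + K₁ * ((2 * l * tvDist μ μ' + G.disc * D) / (2 * ρ)) := by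
    refine tvDist_mix_left fun x => ?_
    have h2 : tvDist (G.bestResp x μ W) (G.bestResp x μ' W') ≤
        (2 * l * tvDist μ μ' + G.disc * D) / (2 * ρ) :=
      tvDist_minimizer_le h.strong hρ (qFun_sub_le_of_flow h hW' hD x μ μ')
        (bellman_le h μ W x) (bellman_le h μ' W' x)
    refine (tvDist_triangle _ (G.transDist x (G.bestResp x μ W) μ') _).trans (add_le_add ?_ ?_)
    · exact tvDist_mix_left fun a => kernel_tvDist_le_of_flow h x a μ μ'
    · exact (tvDist_mix_right (fun a a' => kernel_tvDist_le_of_action h x a a' μ') _ _).trans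
        (mul_le_mul_of_nonneg_left h2 hK)
  have h3 := mul_le_mul_of_nonneg_right
    (le_Khat h.disc_pos.le h.disc_lt_one hl0 hK hρ) (tvDist_nonneg μ μ')
  refine (tvDist_triangle _ _ _).trans ((add_le_add h1 h2).trans (le_trans (le_of_eq ?_)
    (add_le_add_left h3 _)))
  rw [← hl]
  field_simp
  ring

end BestResponse

end RegMFG

/-! ### A weighted contraction principle. -/

section FixedPoint

open Filter Topology

/-- A Banach fixed point theorem for families `ι → E` with a weighted supremum distance that may
be infinite. -/
theorem exists_fixedPoint_of_weighted_contraction {ι E : Type*} [MetricSpace E] [CompleteSpace E]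
    {d : E → E → ℝ} (hcont : Continuous fun p : E × E => d p.1 p.2) (hself : ∀ a, d a a = 0)
    (hcomm : ∀ a b, d a b = d b a) (htri : ∀ a b c, d a c ≤ d a b + d b c)
    {C : ℝ} (hC : 0 ≤ C) (hdist : ∀ a b, dist a b ≤ C * d a b)
    {w : ι → ℝ} {Φ : (ι → E) → ι → E} {l : ℝ} (hl₀ : 0 ≤ l) (hl₁ : l < 1)
    (hΦ : ∀ c, 0 ≤ c → ∀ f g, (∀ i, d (f i) (g i) ≤ c * w i) →
      ∀ i, d (Φ f i) (Φ g i) ≤ l * c * w i)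
    {f₀ : ι → E} {c₀ : ℝ} (hc₀ : 0 ≤ c₀) (h₀ : ∀ i, d (f₀ i) (Φ f₀ i) ≤ c₀ * w i) :
    ∃ f, Φ f = f ∧ ∀ i, d (f₀ i) (f i) ≤ c₀ / (1 - l) * w i := by
  set F : ℕ → ι → E := fun n => Φ^[n] f₀ with hF
  have hl : 0 < 1 - l := sub_pos.2 hl₁
  have hstep : ∀ n i, d (F n i) (F (n + 1) i) ≤ l ^ n * c₀ * w i := by
    intro n
    induction n with
    | zero => simpa [hF] using h₀
    | succ n ih =>
      intro i
      have := hΦ _ (by positivity) _ _ ih i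
      simp only [hF, Function.iterate_succ_apply'] at this ⊢
      refine this.trans_eq (by ring)
  have hlim : ∀ i, ∃ a, Tendsto (fun n => F n i) atTop (𝓝 a) := by
    intro i
    refine cauchySeq_tendsto_of_complete
      (cauchySeq_of_le_geometric l (C * (c₀ * w i)) hl₁ fun n => ?_)
    refine (hdist _ _).trans ((mul_le_mul_of_nonneg_left (hstep n i) hC).trans_eq (by ring))
  choose f hf using hlim
  have hfin : ∀ i n m, d (F n i) (F (n + m) i) ≤ l ^ n * (1 - l ^ m) / (1 - l) * c₀ * w i := by
    intro i n m
    induction m with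
    | zero => simp [hself]
    | succ m ih =>
      refine (htri _ _ _).trans ((add_le_add ih (hstep (n + m) i)).trans_eq ?_)
      field_simp
      ring
  have hnear : ∀ i n, d (F n i) (f i) ≤ l ^ n * (c₀ / (1 - l)) * w i := by
    intro i n
    have h1 : Tendsto (fun m => d (F n i) (F (n + m) i)) atTop (𝓝 (d (F n i) (f i))) :=
      (hcont.tendsto (F n i, f i)).comp (tendsto_const_nhds.prodMk_nhds
        ((hf i).comp (tendsto_add_atTop_nat n |>.congr fun m => by ring_nf)))
    have h2 : Tendsto (fun m : ℕ => l ^ n * (1 - l ^ m) / (1 - l) * c₀ * w i) atTop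
        (𝓝 (l ^ n * (1 - 0) / (1 - l) * c₀ * w i)) :=
      (((((tendsto_pow_atTop_nhds_zero_of_lt_one hl₀ hl₁).const_sub 1).const_mul _).div_const
        _).mul_const _).mul_const _
    refine (le_of_tendsto_of_tendsto' h1 h2 fun m => hfin i n m).trans_eq ?_
    ring
  refine ⟨f, ?_, fun i => by simpa [hF] using hnear i 0⟩
  funext i
  -- `Φ (F n) = F (n + 1)` lies within order `l ^ n` of both `Φ f` and `f`; no continuity of `Φ` is
  -- needed.
  have h1 : ∀ n, dist (Φ f i) (f i) ≤ l ^ n * (C * (l * (c₀ / (1 - l)) * w i * 2)) := by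
    intro n
    have h2 := hΦ _ (by positivity) _ _ (fun i => hnear i n) i
    have h3 := hnear i (n + 1)
    have h4 : Φ (F n) i = F (n + 1) i := by simp only [hF, Function.iterate_succ_apply']
    rw [h4] at h2
    refine (hdist _ _).trans ?_
    have h7 : d (Φ f i) (f i) ≤ l ^ n * (l * (c₀ / (1 - l)) * w i * 2) := by
      have h5 := htri (Φ f i) (F (n + 1) i) (f i)
      rw [hcomm] at h2
      rw [pow_succ] at h3
      linarith
    exact (mul_le_mul_of_nonneg_left h7 hC).trans_eq (by ring)
  have h2 := (tendsto_pow_atTop_nhds_zero_of_lt_one hl₀ hl₁).mul_const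
    (C * (l * (c₀ / (1 - l)) * w i * 2))
  rw [zero_mul] at h2
  exact dist_le_zero.1 (ge_of_tendsto' h2 h1)

end FixedPoint

/-! ### Value functions and their dependence on the flow. -/

namespace RegMFG

variable {X A : Type*} [Fintype X] [Fintype A] [Nonempty A] {G : RegMFG X A} {L₁ K₁ ρ : ℝ}

/-- `V` satisfies the Bellman equation along the flow `μ` at all times before `n`. -/
def BellmanUpTo (G : RegMFG X A) (μ : MFlow X) (V : ℕ → X → ℝ) (n : ℕ) : Prop :=
  ∀ t < n, V t = G.bellman (μ t) (V (t + 1))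

lemma exists_value_inf (h : G.Regular L₁ K₁ ρ) {B : ℝ} (hB₀ : 0 ≤ B)
    (hB : ∀ x u μ, |G.regCost x u μ| ≤ B) (μ : MFlow X) :
    ∃ V : ℕ → X → ℝ, (∀ t, V t = G.bellman (μ t) (V (t + 1))) ∧
      ∀ t x, |V t x| ≤ B / (1 - G.disc) := by
  -- The iteration starts at `0`, which the Bellman operator moves by at most `B`; the distance
  -- bound is then the bound on the values.
  obtain ⟨f, hf, hfB⟩ := exists_fixedPoint_of_weighted_contraction (ι := ℕ × X) (E := ℝ)
    (d := dist) (w := fun _ => 1) (C := 1) (l := G.disc) (c₀ := B) (f₀ := 0)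
    (Φ := fun f p => G.bellman (μ p.1) (fun y => f (p.1 + 1, y)) p.2)
    continuous_dist dist_self dist_comm dist_triangle zero_le_one (by simp)
    h.disc_pos.le h.disc_lt_one
    (fun c hc f g hfg p => by
      simp only [mul_one, Real.dist_eq] at hfg ⊢
      exact abs_bellman_sub_le_disc h (fun y => hfg _) _ _)
    hB₀ (fun p => by
      rw [Real.dist_eq, Pi.zero_apply, zero_sub, abs_neg, mul_one]
      exact abs_bellman_zero_le hB _ _)
  refine ⟨fun t x => f (t, x), fun t => ?_, fun t x => ?_⟩
  · funext x
    exact (congrFun hf (t, x)).symm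
  · simpa using hfB (t, x)

lemma exists_value_fin (G : RegMFG X A) (μ : MFlow X) (n : ℕ) :
    ∃ V : ℕ → X → ℝ, V n = 0 ∧ G.BellmanUpTo μ V n := by
  induction n generalizing μ with
  | zero => exact ⟨0, rfl, fun t ht => absurd ht (Nat.not_lt_zero t)⟩
  | succ n ih =>
    obtain ⟨V, hV, hV'⟩ := ih fun t => μ (t + 1)
    refine ⟨fun t => Nat.casesOn t (G.bellman (μ 0) (V 0)) V, hV, fun t ht => ?_⟩
    cases t with
    | zero => rfl
    | succ t => exact hV' t (by omega)

/-- Each backward step multiplies the excess `r` over `L̄` by `βK₁/2`. Finite horizons use `r = 0`;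
for infinite ones `r` is a crude bound and `k → ∞`. -/
lemma value_sub_le (h : G.Regular L₁ K₁ ρ) {μ : MFlow X} {V : ℕ → X → ℝ} {n : ℕ}
    (hV : G.BellmanUpTo μ V n) {r : ℝ} (hn : ∀ y z, V n y - V n z ≤ Lbar L₁ K₁ G.disc + r)
    {k t : ℕ} (hk : t + k = n) (y z : X) :
    V t y - V t z ≤ Lbar L₁ K₁ G.disc + (G.disc * K₁ / 2) ^ k * r := by
  induction k generalizing t y z with
  | zero => subst hk; simpa using hn y z
  | succ k ih =>
    rw [hV t (by omega)]
    have := bellman_sub_le h (ih (t := t + 1) (by omega)) (μ t) y z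
    refine this.trans_eq ?_
    conv_rhs => rw [← Lbar_eq h.disc_mul_lt]
    ring

lemma value_fin_sub_le (h : G.Regular L₁ K₁ ρ) {μ : MFlow X} {V : ℕ → X → ℝ} {n : ℕ}
    (hV : G.BellmanUpTo μ V n) (hn : V n = 0) {t : ℕ} (ht : t ≤ n) (y z : X) :
    V t y - V t z ≤ Lbar L₁ K₁ G.disc := by
  have := value_sub_le h hV (r := 0)
    (fun _ _ => by simpa [hn] using Lbar_nonneg h.L_nonneg h.disc_mul_lt)
    (k := n - t) (Nat.add_sub_cancel' ht) y z
  simpa using this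

lemma value_inf_sub_le (h : G.Regular L₁ K₁ ρ) {μ : MFlow X} {V : ℕ → X → ℝ}
    (hV : ∀ t, V t = G.bellman (μ t) (V (t + 1))) {B : ℝ} (hB : ∀ t x, |V t x| ≤ B)
    (t : ℕ) (y z : X) : V t y - V t z ≤ Lbar L₁ K₁ G.disc := by
  have h0 : 0 ≤ G.disc * K₁ / 2 := by have := h.disc_pos; have := h.K_nonneg; positivity
  have h1 := ((tendsto_pow_atTop_nhds_zero_of_lt_one h0 h.disc_mul_lt).mul_const
    (2 * B)).const_add (Lbar L₁ K₁ G.disc)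
  rw [zero_mul, add_zero] at h1
  refine ge_of_tendsto' h1 fun k => value_sub_le h (n := t + k) (fun s _ => hV s)
    (fun y z => ?_) rfl y z
  have h2 := abs_le.1 (hB (t + k) y)
  have h3 := abs_le.1 (hB (t + k) z)
  have h4 := Lbar_nonneg h.L_nonneg h.disc_mul_lt
  linarith

/-- The contraction factor for flows with the weights `x ^ t`. -/
noncomputable def rate (G : RegMFG X A) (L₁ K₁ ρ x : ℝ) : ℝ :=
  Khat L₁ K₁ G.disc ρ / x +
    (Khat L₁ K₁ G.disc ρ - Kbar L₁ K₁ G.disc ρ) * G.disc / (1 - G.disc * x)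

/-- Dependence of the value functions on the flow. -/
lemma abs_value_sub_le (h : G.Regular L₁ K₁ ρ) {μ μ' : MFlow X} {V V' : ℕ → X → ℝ} {n : ℕ}
    (hV : G.BellmanUpTo μ V n) (hV' : G.BellmanUpTo μ' V' n)
    (hosc : ∀ t ≤ n, ∀ y z, V' t y - V' t z ≤ Lbar L₁ K₁ G.disc)
    {B : ℝ} (hB : ∀ y, |V n y - V' n y| ≤ B) {c x : ℝ} (hc : 0 ≤ c) (hx : 0 < x)
    (hx₁ : G.disc * x < 1) (he : ∀ t < n, tvDist (μ t) (μ' t) ≤ c * x ^ t)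
    {k t : ℕ} (hk : t + k = n) (y : X) :
    |V t y - V' t y| ≤
      2 * Lbar L₁ K₁ G.disc * (c * x ^ t) / (1 - G.disc * x) + G.disc ^ k * B := by
  have hl := Lbar_nonneg h.L_nonneg h.disc_mul_lt
  have hx₂ : 0 < 1 - G.disc * x := sub_pos.2 hx₁
  induction k generalizing t y with
  | zero =>
    subst hk
    have : 0 ≤ 2 * Lbar L₁ K₁ G.disc * (c * x ^ (t + 0)) / (1 - G.disc * x) := by positivity
    simpa using (hB y).trans (by simpa using this)
  | succ k ih =>
    rw [hV t (by omega), hV' t (by omega)]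
    refine (abs_bellman_sub_le h (hosc (t + 1) (by omega)) (ih (by omega)) _ _ y).trans ?_
    have h1 : 2 * Lbar L₁ K₁ G.disc * tvDist (μ t) (μ' t) ≤
        2 * Lbar L₁ K₁ G.disc * (c * x ^ t) :=
      mul_le_mul_of_nonneg_left (he t (by omega)) (by positivity)
    -- The backward recursion closes because `a + βx · a / (1 - βx) = a / (1 - βx)`.
    refine (add_le_add_left h1 _).trans_eq ?_
    field_simp
    ring

/-- One step of the population dynamics in the weighted distance. -/
lemma tvDist_nextBest_le_rate (h : G.Regular L₁ K₁ ρ) {μ μ' : MFlow X} {V V' : ℕ → X → ℝ} {n : ℕ}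
    (hV : G.BellmanUpTo μ V n) (hV' : G.BellmanUpTo μ' V' n)
    (hosc : ∀ t ≤ n, ∀ y z, V t y - V t z ≤ Lbar L₁ K₁ G.disc)
    (hosc' : ∀ t ≤ n, ∀ y z, V' t y - V' t z ≤ Lbar L₁ K₁ G.disc)
    {B : ℝ} (hB : ∀ y, |V n y - V' n y| ≤ B) {c x : ℝ} (hc : 0 ≤ c) (hx : 0 < x)
    (hx₁ : G.disc * x < 1) (he : ∀ t < n, tvDist (μ t) (μ' t) ≤ c * x ^ t)
    {k t : ℕ} (hk : t + k + 1 = n) :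
    tvDist (G.nextBest (μ t) (V (t + 1))) (G.nextBest (μ' t) (V' (t + 1))) ≤
      G.rate L₁ K₁ ρ x * c * x ^ (t + 1) + K₁ / (2 * ρ) * B * G.disc ^ (k + 1) := by
  have hl := Lbar_nonneg h.L_nonneg h.disc_mul_lt
  have hρ := h.rho_pos
  have hx₂ : 0 < 1 - G.disc * x := sub_pos.2 hx₁
  have h1 := tvDist_nextBest_le h (hosc (t + 1) (by omega)) (hosc' (t + 1) (by omega))
    (abs_value_sub_le h hV hV' hosc' hB hc hx hx₁ he (k := k) (t := t + 1) (by omega))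
    (μ t) (μ' t)
  have h2 : 0 ≤ Khat L₁ K₁ G.disc ρ := le_trans (by have := h.K_nonneg; positivity)
    (le_Khat h.disc_pos.le h.disc_lt_one hl h.K_nonneg hρ)
  refine h1.trans ((add_le_add_left (mul_le_mul_of_nonneg_left (he t (by omega)) h2) _).trans_eq ?_)
  rw [rate, Khat_sub_Kbar]
  field_simp
  ring

end RegMFG

/-! ### Performance differences and the characterization of optimal policies. -/

namespace RegMFG

variable {X A : Type*} [Fintype X] [Fintype A] {G : RegMFG X A} {L₁ K₁ ρ : ℝ}

lemma continuous_trans (G : RegMFG X A) (x : X) (μ : PDist X) (y : X) :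
    Continuous fun u => G.trans x u μ y :=
  continuous_finsetSum _ fun a _ => continuous_const.mul (continuous_coord a)

lemma integrable_trans (G : RegMFG X A) (x : X) (μ : PDist X) (y : X)
    (q : ProbabilityMeasure (PDist A)) :
    Integrable (fun u => G.trans x u μ y) (q : Measure (PDist A)) :=
  (continuous_trans G x μ y).integrable_of_hasCompactSupport (HasCompactSupport.of_compactSpace _)

lemma integrable_regCost (h : G.Regular L₁ K₁ ρ) (x : X) (μ : PDist X)
    (q : ProbabilityMeasure (PDist A)) :
    Integrable (fun u => G.regCost x u μ) (q : Measure (PDist A)) :=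
  (continuous_regLin h.cont (fun a => G.cost x a μ)).integrable_of_hasCompactSupport
    (HasCompactSupport.of_compactSpace _)

lemma integrable_regLin (h : G.Regular L₁ K₁ ρ) (w : A → ℝ) (q : ProbabilityMeasure (PDist A)) :
    Integrable (regLin G.reg w) (q : Measure (PDist A)) :=
  (continuous_regLin h.cont w).integrable_of_hasCompactSupport (HasCompactSupport.of_compactSpace _)

lemma integral_trans_nonneg (G : RegMFG X A) (x : X) (μ : PDist X) (y : X)
    (q : ProbabilityMeasure (PDist A)) : 0 ≤ ∫ u, G.trans x u μ y ∂(q : Measure (PDist A)) :=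
  integral_nonneg fun u => stdSimplex.zero_le (G.transDist x u μ) y

lemma sum_integral_trans (G : RegMFG X A) (x : X) (μ : PDist X)
    (q : ProbabilityMeasure (PDist A)) :
    ∑ y, ∫ u, G.trans x u μ y ∂(q : Measure (PDist A)) = 1 := by
  rw [← integral_finsetSum _ fun y _ => integrable_trans G x μ y q]
  have : ∀ u, ∑ y, G.trans x u μ y = 1 := fun u => stdSimplex.sum_eq_one (G.transDist x u μ)
  simp [this]

lemma stateLaw_nonneg (G : RegMFG X A) (μ : MFlow X) {m : X → ℝ} (hm : ∀ x, 0 ≤ m x)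
    (π : Policy X A) (t : ℕ) (x : X) : 0 ≤ G.stateLaw μ m π t x := by
  induction t generalizing x with
  | zero => exact hm x
  | succ t ih =>
    exact Finset.sum_nonneg fun y _ => mul_nonneg (ih y) (integral_trans_nonneg G y _ x _)

lemma sum_stateLaw (G : RegMFG X A) (μ : MFlow X) (m : X → ℝ) (π : Policy X A) (t : ℕ) :
    ∑ x, G.stateLaw μ m π t x = ∑ x, m x := by
  induction t with
  | zero => rfl
  | succ t ih =>
    rw [← ih]
    simp only [stateLaw, nextLaw]
    rw [Finset.sum_comm]
    simp only [← Finset.mul_sum, sum_integral_trans, mul_one]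

/-- Under consistency the states charged by the population are those that a single player visits, so
optimality gives information exactly there. -/
lemma stateLaw_eq_of_evol {μ : MFlow X} {π : Policy X A} {n : ℕ} (h₀ : μ 0 = G.init)
    (h : ∀ t < n, ∀ y, μ (t + 1) y = G.nextLaw (μ t) (π t) (μ t) y) {t : ℕ} (ht : t ≤ n) (x : X) :
    G.stateLaw μ G.init π t x = μ t x := by
  induction t generalizing x with
  | zero => rw [h₀]; rfl
  | succ t ih =>
    rw [h t (by omega)]
    have : G.stateLaw μ G.init π t = μ t := funext fun x => ih (by omega) x
    simp only [stateLaw, this]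

lemma abs_sum_stateLaw_mul_le (G : RegMFG X A) (μ : MFlow X) {m : X → ℝ} (hm : ∀ x, 0 ≤ m x)
    (hm₁ : ∑ x, m x = 1) (π : Policy X A) (t : ℕ) {f : X → ℝ} {B : ℝ} (hf : ∀ x, |f x| ≤ B) :
    |∑ x, G.stateLaw μ m π t x * f x| ≤ B := by
  have := abs_sum_mul_le hf ⟨_, fun x => stateLaw_nonneg G μ hm π t x,
    (sum_stateLaw G μ m π t).trans hm₁⟩
  refine (le_of_eq ?_).trans this
  exact congrArg _ (Finset.sum_congr rfl fun x _ => mul_comm _ _)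

lemma abs_expCost_le {B : ℝ} (hB : ∀ x u μ, |G.regCost x u μ| ≤ B) (μ : MFlow X) {m : X → ℝ}
    (hm : ∀ x, 0 ≤ m x) (hm₁ : ∑ x, m x = 1) (π : Policy X A) (t : ℕ) :
    |G.expCost μ m π t| ≤ B := by
  refine abs_sum_stateLaw_mul_le G μ hm hm₁ π t fun x => ?_
  simpa using norm_integral_le_of_norm_le_const (μ := (π t x : Measure (PDist A)))
    (f := fun u => G.regCost x u (μ t)) (C := B) (Filter.Eventually.of_forall fun u => hB x u (μ t))

lemma hasSum_objInf (h : G.Regular L₁ K₁ ρ) (μ : MFlow X) {m : X → ℝ}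
    (hm : ∀ x, 0 ≤ m x) (hm₁ : ∑ x, m x = 1) (π : Policy X A) :
    HasSum (fun t => G.disc ^ t * G.expCost μ m π t) (G.objInf μ m π) := by
  obtain ⟨B, -, hB⟩ := exists_abs_regCost_le h
  refine Summable.hasSum (Summable.of_norm_bounded (g := fun t => G.disc ^ t * B)
    ((summable_geometric_of_lt_one h.disc_pos.le h.disc_lt_one).mul_right B) fun t => ?_)
  rw [Real.norm_eq_abs, abs_mul, abs_pow, abs_of_pos h.disc_pos]
  exact mul_le_mul_of_nonneg_left (abs_expCost_le hB μ hm hm₁ π t) (pow_nonneg h.disc_pos.le t)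

variable [Nonempty A]

/-- The loss at time `t` and in state `x`, compared with the value function `V`. -/
noncomputable def gapAt (G : RegMFG X A) (μ : MFlow X) (V : ℕ → X → ℝ) (π : Policy X A)
    (t : ℕ) (x : X) : ℝ :=
  ∫ u, (regLin G.reg (G.qFun x (μ t) (V (t + 1))) u - G.bellman (μ t) (V (t + 1)) x)
    ∂(π t x : Measure (PDist A))

lemma gapAt_nonneg (h : G.Regular L₁ K₁ ρ) (μ : MFlow X) (V : ℕ → X → ℝ) (π : Policy X A)
    (t : ℕ) (x : X) : 0 ≤ G.gapAt μ V π t x :=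
  integral_nonneg fun u => sub_nonneg.2 (bellman_le h _ _ x u)

lemma gapAt_eq (h : G.Regular L₁ K₁ ρ) (μ : MFlow X) (V : ℕ → X → ℝ) (π : Policy X A)
    (t : ℕ) (x : X) :
    G.gapAt μ V π t x = ∫ u, G.regCost x u (μ t) ∂(π t x : Measure (PDist A)) +
      G.disc * ∑ y, V (t + 1) y * ∫ u, G.trans x u (μ t) y ∂(π t x : Measure (PDist A)) -
      G.bellman (μ t) (V (t + 1)) x := by
  have hi : ∀ y, Integrable (fun u => V (t + 1) y * G.trans x u (μ t) y)
      (π t x : Measure (PDist A)) := fun y => (integrable_trans G x (μ t) y (π t x)).const_mul _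
  rw [gapAt, integral_sub (integrable_regLin h _ _) (integrable_const _)]
  simp only [regLin_qFun]
  rw [integral_add (integrable_regCost h x (μ t) (π t x))
    ((integrable_finsetSum _ fun y _ => hi y).const_mul _), integral_const_mul,
    integral_finsetSum _ fun y _ => hi y]
  simp [integral_const_mul]

lemma gapAt_dirac (G : RegMFG X A) {μ : MFlow X} {V : ℕ → X → ℝ} {π : Policy X A} {t : ℕ} {x : X}
    (hπ : (π t x : Measure (PDist A)) = Measure.dirac (G.bestResp x (μ t) (V (t + 1)))) :
    G.gapAt μ V π t x = 0 := by
  rw [gapAt, hπ, integral_dirac]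
  simp [bellman]

/-- A nonnegative integrand with zero integral vanishes almost everywhere, and quadratic growth
leaves one point where it can vanish. -/
lemma eq_dirac_of_gapAt_le (h : G.Regular L₁ K₁ ρ) {μ : MFlow X} {V : ℕ → X → ℝ}
    {π : Policy X A} {t : ℕ} {x : X} (hg : G.gapAt μ V π t x ≤ 0) :
    (π t x : Measure (PDist A)) = Measure.dirac (G.bestResp x (μ t) (V (t + 1))) := by
  set b := G.bestResp x (μ t) (V (t + 1)) with hb
  have h1 := (integral_eq_zero_iff_of_nonneg
    (fun u => sub_nonneg.2 (bellman_le h (μ t) (V (t + 1)) x u))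
    ((integrable_regLin h _ (π t x)).sub (integrable_const _))).1
    (le_antisymm hg (gapAt_nonneg h μ V π t x))
  have h2 : ∀ᵐ u ∂(π t x : Measure (PDist A)), u = b := by
    filter_upwards [h1] with u hu
    have h3 := quadratic_growth h.strong (bellman_le h (μ t) (V (t + 1)) x) u
    have h4 : regLin G.reg (G.qFun x (μ t) (V (t + 1))) u =
        regLin G.reg (G.qFun x (μ t) (V (t + 1))) b := sub_eq_zero.1 hu
    have h5 := h.rho_pos
    have h6 : tvDist u b ^ 2 ≤ 0 := by
      have : ρ * tvDist u b ^ 2 ≤ 0 := by rw [h4] at h3; linarith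
      exact nonpos_of_mul_nonpos_right this h5
    exact eq_of_tvDist_le_zero (le_of_eq (pow_eq_zero_iff two_ne_zero |>.1
      (le_antisymm h6 (sq_nonneg _))))
  ext s hs
  rw [Measure.dirac_apply' _ hs]
  by_cases hbs : b ∈ s
  · rw [Set.indicator_of_mem hbs, Pi.one_apply]
    exact (prob_compl_eq_zero_iff hs).1 (measure_mono_null (fun u hu (hub : u = b) => hu (hub ▸ hbs)) h2)
  · rw [Set.indicator_of_notMem hbs]
    exact measure_mono_null (fun u hu (hub : u = b) => hbs (hub ▸ hu)) h2

/-- The expected loss at time `t`. -/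
noncomputable def gap (G : RegMFG X A) (μ : MFlow X) (V : ℕ → X → ℝ) (m : X → ℝ)
    (π : Policy X A) (t : ℕ) : ℝ :=
  ∑ x, G.stateLaw μ m π t x * G.gapAt μ V π t x

lemma gap_nonneg (h : G.Regular L₁ K₁ ρ) (μ : MFlow X) (V : ℕ → X → ℝ) {m : X → ℝ}
    (hm : ∀ x, 0 ≤ m x) (π : Policy X A) (t : ℕ) : 0 ≤ G.gap μ V m π t :=
  Finset.sum_nonneg fun x _ =>
    mul_nonneg (stateLaw_nonneg G μ hm π t x) (gapAt_nonneg h μ V π t x)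

/-- In this form the discounted gaps telescope when summed over time. -/
lemma gap_eq (h : G.Regular L₁ K₁ ρ) {μ : MFlow X} {V : ℕ → X → ℝ} (m : X → ℝ)
    (π : Policy X A) {t : ℕ} (hV : V t = G.bellman (μ t) (V (t + 1))) :
    G.gap μ V m π t = G.expCost μ m π t + G.disc * ∑ y, G.stateLaw μ m π (t + 1) y * V (t + 1) y -
      ∑ x, G.stateLaw μ m π t x * V t x := by
  have h1 : ∑ y, G.stateLaw μ m π (t + 1) y * V (t + 1) y = ∑ x, G.stateLaw μ m π t x *
      ∑ y, V (t + 1) y * ∫ u, G.trans x u (μ t) y ∂(π t x : Measure (PDist A)) := by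
    simp only [stateLaw, nextLaw, Finset.sum_mul, Finset.mul_sum]
    rw [Finset.sum_comm]
    exact Finset.sum_congr rfl fun x _ => Finset.sum_congr rfl fun y _ => by ring
  rw [h1]
  simp only [gap, gapAt_eq h, expCost, hV]
  rw [Finset.mul_sum, ← Finset.sum_add_distrib, ← Finset.sum_sub_distrib]
  exact Finset.sum_congr rfl fun x _ => by ring

/-- The performance difference formula. -/
lemma sum_expCost_eq (h : G.Regular L₁ K₁ ρ) {μ : MFlow X} {V : ℕ → X → ℝ} {n : ℕ} (m : X → ℝ)
    (π : Policy X A) (hV : G.BellmanUpTo μ V n) :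
    ∑ t ∈ Finset.range n, G.disc ^ t * G.expCost μ m π t =
      ∑ x, m x * V 0 x - G.disc ^ n * ∑ x, G.stateLaw μ m π n x * V n x +
      ∑ t ∈ Finset.range n, G.disc ^ t * G.gap μ V m π t := by
  induction n with
  | zero => simp [stateLaw]
  | succ n ih =>
    rw [Finset.sum_range_succ, Finset.sum_range_succ, ih fun t ht => hV t (by omega),
      gap_eq h m π (hV n (by omega))]
    ring

/-- The policy which plays the best responses to the values `V`. -/
noncomputable def bestPolicy (G : RegMFG X A) (μ : MFlow X) (V : ℕ → X → ℝ) : Policy X A :=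
  fun t x => ⟨Measure.dirac (G.bestResp x (μ t) (V (t + 1))), inferInstance⟩

lemma gap_bestPolicy (G : RegMFG X A) (μ : MFlow X) (V : ℕ → X → ℝ) (m : X → ℝ) (t : ℕ) :
    G.gap μ V m (G.bestPolicy μ V) t = 0 :=
  Finset.sum_eq_zero fun x _ => by rw [gapAt_dirac G rfl, mul_zero]

lemma eq_bestPolicy_of_gap_le (h : G.Regular L₁ K₁ ρ) {μ : MFlow X} {V : ℕ → X → ℝ} {m : X → ℝ}
    (hm : ∀ x, 0 ≤ m x) {π : Policy X A} {t : ℕ} (hg : G.gap μ V m π t ≤ 0) {x : X}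
    (hx : 0 < G.stateLaw μ m π t x) : π t x = G.bestPolicy μ V t x := by
  have h1 := (Finset.sum_eq_zero_iff_of_nonneg fun x _ => mul_nonneg
    (stateLaw_nonneg G μ hm π t x) (gapAt_nonneg h μ V π t x)).1
    (le_antisymm hg (gap_nonneg h μ V hm π t)) x (Finset.mem_univ x)
  exact Subtype.ext (eq_dirac_of_gapAt_le h
    ((mul_eq_zero.1 h1).resolve_left hx.ne').le)

/-- Comparison with `bestPolicy`, whose gaps are all zero, makes a sum of nonnegative terms
nonpositive. -/
lemma gap_le_of_optimal_fin (h : G.Regular L₁ K₁ ρ) {μ : MFlow X} {V : ℕ → X → ℝ} {m : X → ℝ}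
    (hm : ∀ x, 0 ≤ m x) {T : ℕ} (hV : G.BellmanUpTo μ V (T + 1)) (hT : V (T + 1) = 0)
    {π : Policy X A} (hπ : ∀ π', G.objT T μ m π ≤ G.objT T μ m π') {t : ℕ} (ht : t ≤ T) :
    G.gap μ V m π t ≤ 0 := by
  have h1 := hπ (G.bestPolicy μ V)
  simp only [objT] at h1
  rw [sum_expCost_eq h m _ hV, sum_expCost_eq h m _ hV, hT] at h1
  simp only [gap_bestPolicy, mul_zero, Finset.sum_const_zero, Pi.zero_apply, sub_zero,
    add_zero, add_le_iff_nonpos_right] at h1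
  have h2 := Finset.single_le_sum (f := fun t => G.disc ^ t * G.gap μ V m π t)
    (fun t _ => mul_nonneg (pow_nonneg h.disc_pos.le t) (gap_nonneg h μ V hm π t))
    (Finset.mem_range.2 (Nat.lt_succ_of_le ht))
  exact nonpos_of_mul_nonpos_right (h2.trans h1) (pow_pos h.disc_pos t)

section InfiniteHorizon

variable {μ : MFlow X} {V : ℕ → X → ℝ} {m : X → ℝ} {B : ℝ}

/-- Boundedness of `V` and discounting remove the terminal term of the performance difference
formula. -/
lemma tendsto_sum_gap (h : G.Regular L₁ K₁ ρ) (hV : ∀ t, V t = G.bellman (μ t) (V (t + 1)))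
    (hB : ∀ t x, |V t x| ≤ B) (hm : ∀ x, 0 ≤ m x) (hm₁ : ∑ x, m x = 1) (π : Policy X A) :
    Filter.Tendsto (fun n => ∑ t ∈ Finset.range n, G.disc ^ t * G.gap μ V m π t) Filter.atTop
      (nhds (G.objInf μ m π - ∑ x, m x * V 0 x)) := by
  have h1 := (hasSum_objInf h μ hm hm₁ π).tendsto_sum_nat
  have h2 : Filter.Tendsto (fun n => G.disc ^ n * ∑ x, G.stateLaw μ m π n x * V n x) Filter.atTop
      (nhds 0) := by
    have h3 := (tendsto_pow_atTop_nhds_zero_of_lt_one h.disc_pos.le h.disc_lt_one).mul_const B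
    rw [zero_mul] at h3
    refine squeeze_zero_norm (fun n => ?_) h3
    rw [Real.norm_eq_abs, abs_mul, abs_pow, abs_of_pos h.disc_pos]
    exact mul_le_mul_of_nonneg_left (abs_sum_stateLaw_mul_le G μ hm hm₁ π n (hB n))
      (pow_nonneg h.disc_pos.le n)
  have h3 := (h1.sub_const (∑ x, m x * V 0 x)).add h2
  rw [add_zero] at h3
  refine h3.congr fun n => ?_
  rw [sum_expCost_eq h m π fun t _ => hV t]
  ring

lemma objInf_bestPolicy (h : G.Regular L₁ K₁ ρ) (hV : ∀ t, V t = G.bellman (μ t) (V (t + 1)))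
    (hB : ∀ t x, |V t x| ≤ B) (hm : ∀ x, 0 ≤ m x) (hm₁ : ∑ x, m x = 1) :
    G.objInf μ m (G.bestPolicy μ V) = ∑ x, m x * V 0 x := by
  have h1 := tendsto_sum_gap h hV hB hm hm₁ (G.bestPolicy μ V)
  simp only [gap_bestPolicy, mul_zero, Finset.sum_const_zero] at h1
  linarith [tendsto_nhds_unique h1 tendsto_const_nhds]

/-- Retaining a single gap suffices to show that each gap of an optimal policy vanishes. -/
lemma le_objInf (h : G.Regular L₁ K₁ ρ) (hV : ∀ t, V t = G.bellman (μ t) (V (t + 1)))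
    (hB : ∀ t x, |V t x| ≤ B) (hm : ∀ x, 0 ≤ m x) (hm₁ : ∑ x, m x = 1) (π : Policy X A) (s : ℕ) :
    ∑ x, m x * V 0 x + G.disc ^ s * G.gap μ V m π s ≤ G.objInf μ m π := by
  have h1 : ∀ t, 0 ≤ G.disc ^ t * G.gap μ V m π t := fun t =>
    mul_nonneg (pow_nonneg h.disc_pos.le t) (gap_nonneg h μ V hm π t)
  have h2 := ge_of_tendsto (tendsto_sum_gap h hV hB hm hm₁ π)
    (Filter.eventually_atTop.2 ⟨s + 1, fun n hn => Finset.single_le_sum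
      (f := fun t => G.disc ^ t * G.gap μ V m π t) (fun t _ => h1 t)
      (Finset.mem_range.2 (show s < n by omega))⟩)
  linarith

lemma bestPolicy_optimal (h : G.Regular L₁ K₁ ρ) (hV : ∀ t, V t = G.bellman (μ t) (V (t + 1)))
    (hB : ∀ t x, |V t x| ≤ B) (hm : ∀ x, 0 ≤ m x) (hm₁ : ∑ x, m x = 1) (π : Policy X A) :
    G.objInf μ m (G.bestPolicy μ V) ≤ G.objInf μ m π := by
  rw [objInf_bestPolicy h hV hB hm hm₁]
  have h1 := le_objInf h hV hB hm hm₁ π 0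
  have h2 := gap_nonneg h μ V hm π 0
  rw [pow_zero, one_mul] at h1
  linarith

lemma gap_le_of_optimal_inf (h : G.Regular L₁ K₁ ρ)
    (hV : ∀ t, V t = G.bellman (μ t) (V (t + 1)))
    (hB : ∀ t x, |V t x| ≤ B) (hm : ∀ x, 0 ≤ m x) (hm₁ : ∑ x, m x = 1) {π : Policy X A}
    (hπ : ∀ π', G.objInf μ m π ≤ G.objInf μ m π') (t : ℕ) : G.gap μ V m π t ≤ 0 := by
  have h1 := le_objInf h hV hB hm hm₁ π t
  have h2 := hπ (G.bestPolicy μ V)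
  rw [objInf_bestPolicy h hV hB hm hm₁] at h2
  exact nonpos_of_mul_nonpos_right (by linarith) (pow_pos h.disc_pos t)

lemma optimalFromEverywhere_bestPolicy (h : G.Regular L₁ K₁ ρ)
    (hV : ∀ t, V t = G.bellman (μ t) (V (t + 1))) (hB : ∀ t x, |V t x| ≤ B) :
    G.OptimalFromEverywhere (G.bestPolicy μ V) μ := by
  classical
  intro s x π'
  convert bestPolicy_optimal (μ := fun t => μ (s + t)) (V := fun t => V (s + t)) h
    (fun t => hV (s + t)) (fun t => hB (s + t)) (single_mem_stdSimplex ℝ x).1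
    (single_mem_stdSimplex ℝ x).2 π' using 1
  congr

/-- Starting at time `s` from the point mass at `x` charges `x`, so the policy is determined also
where the equilibrium flow has no mass. -/
lemma eq_bestPolicy_of_optimalFromEverywhere (h : G.Regular L₁ K₁ ρ)
    (hV : ∀ t, V t = G.bellman (μ t) (V (t + 1))) (hB : ∀ t x, |V t x| ≤ B) {π : Policy X A}
    (hπ : G.OptimalFromEverywhere π μ) : π = G.bestPolicy μ V := by
  classical
  funext s x
  have hm := single_mem_stdSimplex ℝ x
  have h1 := gap_le_of_optimal_inf (μ := fun t => μ (s + t)) (V := fun t => V (s + t))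
    (π := fun t => π (s + t)) h (fun t => hV (s + t)) (fun t => hB (s + t)) hm.1 hm.2
    (fun π' => by convert hπ s x π') 0
  exact eq_bestPolicy_of_gap_le h hm.1 h1 (x := x) (by simp [stateLaw])

end InfiniteHorizon

/-- The evolution of the population when the support of the law plays best responses. -/
lemma eq_nextBest_of_evol (h : G.Regular L₁ K₁ ρ) {μ : MFlow X} {V : ℕ → X → ℝ} {π : Policy X A}
    {n : ℕ} (h₀ : μ 0 = G.init) (hev : ∀ t < n, ∀ y, μ (t + 1) y = G.nextLaw (μ t) (π t) (μ t) y)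
    {t : ℕ} (ht : t < n) (hg : G.gap μ V G.init π t ≤ 0) :
    μ (t + 1) = G.nextBest (μ t) (V (t + 1)) := by
  refine stdSimplex.ext (funext fun y => ?_)
  rw [hev t ht y]
  refine Finset.sum_congr rfl fun x _ => ?_
  rw [mul_comm, transDist_apply]
  -- The policy is unconstrained at states without mass, but these do not contribute to the next
  -- law.
  rcases (stdSimplex.zero_le (μ t) x).eq_or_lt with h1 | h1
  · rw [← h1, mul_zero, mul_zero]
  · rw [← stateLaw_eq_of_evol h₀ hev ht.le] at h1
    rw [eq_bestPolicy_of_gap_le h (stdSimplex.zero_le G.init) hg h1]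
    simp [bestPolicy]

end RegMFG

/-! ### Bounds for spectral radii. -/

section SpectralRadius

open scoped ENNReal NNReal

/-- The Collatz–Wielandt argument: the eigenvalue equation is read in the row where `‖v i‖ / w i` is
largest. -/
lemma norm_le_of_mem_spectrum {n : ℕ} {A : Matrix (Fin n) (Fin n) ℝ} (hA : ∀ i j, 0 ≤ A i j)
    {w : Fin n → ℝ} (hw : ∀ i, 0 < w i) {r : ℝ} (hr : ∀ i, ∑ j, A i j * w j ≤ r * w i) {z : ℂ}
    (hz : z ∈ spectrum ℂ (A.map ((↑) : ℝ → ℂ))) : ‖z‖ ≤ r := by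
  rw [← Matrix.spectrum_toLin', ← Module.End.hasEigenvalue_iff_mem_spectrum] at hz
  obtain ⟨v, hv⟩ := hz.exists_hasEigenvector
  have hv₀ : v ≠ 0 := hv.2
  have hvz := hv.apply_eq_smul
  rw [Matrix.toLin'_apply] at hvz
  obtain ⟨k, hk⟩ := Function.ne_iff.1 hv₀
  have : Nonempty (Fin n) := ⟨k⟩
  obtain ⟨i, hi⟩ := Finite.exists_max fun i : Fin n => ‖v i‖ / w i
  have hM : 0 < ‖v i‖ / w i := (div_pos (norm_pos_iff.2 hk) (hw k)).trans_le (hi k)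
  have h1 : ‖z‖ * ‖v i‖ ≤ ∑ j, A i j * ‖v j‖ := by
    have h2 := congrFun hvz i
    rw [Pi.smul_apply, smul_eq_mul] at h2
    rw [← norm_mul, ← h2]
    change ‖∑ j, A.map ((↑) : ℝ → ℂ) i j * v j‖ ≤ _
    refine (norm_sum_le _ _).trans (Finset.sum_le_sum fun j _ => ?_)
    rw [norm_mul, Matrix.map_apply, Complex.norm_real, Real.norm_of_nonneg (hA i j)]
  have h2 : ∑ j, A i j * ‖v j‖ ≤ ‖v i‖ / w i * (r * w i) := by
    refine le_trans ?_ (mul_le_mul_of_nonneg_left (hr i) hM.le)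
    rw [Finset.mul_sum]
    refine Finset.sum_le_sum fun j _ => ?_
    have h3 := (div_le_iff₀ (hw j)).1 (hi j)
    calc A i j * ‖v j‖ ≤ A i j * (‖v i‖ / w i * w j) := mul_le_mul_of_nonneg_left h3 (hA i j)
      _ = _ := by ring
  have h3 : ‖v i‖ / w i * (r * w i) = r * ‖v i‖ := by field_simp [(hw i).ne']
  have h4 : 0 < ‖v i‖ := by simpa [hw i] using (div_pos_iff_of_pos_right (hw i)).1 hM
  exact le_of_mul_le_mul_right (h1.trans (h2.trans_eq h3)) h4

lemma exists_ne_zero_mem_spectrum {n : ℕ} {A : Matrix (Fin n) (Fin n) ℂ} (hA : A.trace ≠ 0) :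
    ∃ z ∈ spectrum ℂ A, z ≠ 0 := by
  by_contra! h
  apply hA
  rw [Matrix.trace_eq_sum_roots_charpoly]
  refine Multiset.sum_eq_zero fun z hz => h z ?_
  rw [Matrix.mem_spectrum_iff_isRoot_charpoly]
  exact Polynomial.isRoot_of_mem_roots hz

lemma spectralRadius_le_ofReal {n : ℕ} {A : Matrix (Fin n) (Fin n) ℂ} {r : ℝ}
    (hr : ∀ z ∈ spectrum ℂ A, ‖z‖ ≤ r) : spectralRadius ℂ A ≤ ENNReal.ofReal r :=
  iSup₂_le fun z hz => by
    rw [← enorm_eq_nnnorm, ← ofReal_norm]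
    exact ENNReal.ofReal_le_ofReal (hr z hz)

/-- The bound `r` supplies finiteness, since `toReal` sends infinity to zero. -/
lemma spectralRadius_toReal_pos {n : ℕ} {A : Matrix (Fin n) (Fin n) ℂ} {r : ℝ}
    (hr : ∀ z ∈ spectrum ℂ A, ‖z‖ ≤ r) (hA : A.trace ≠ 0) : 0 < (spectralRadius ℂ A).toReal := by
  obtain ⟨z, hz, hz₀⟩ := exists_ne_zero_mem_spectrum hA
  refine ENNReal.toReal_pos ?_ (ne_top_of_le_ne_top ENNReal.ofReal_ne_top
    (spectralRadius_le_ofReal hr))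
  have h1 : (‖z‖₊ : ℝ≥0∞) ≤ spectralRadius ℂ A := le_iSup₂_of_le z hz le_rfl
  have h2 : (0 : ℝ≥0∞) < ‖z‖₊ := by simpa using hz₀
  exact (h2.trans_le h1).ne'

end SpectralRadius

/-! ### The matrix `A_T`. -/

section HessenbergMatrix

variable {L₁ K₁ β ρ : ℝ}

lemma sum_Ico_pow_mul_le {β x : ℝ} (hβ : 0 ≤ β) (hx : 0 < x) (hβx : β * x < 1) (i T : ℕ) :
    ∑ j ∈ Finset.Ico i T, β ^ (j + 1 - i) * x ^ (j + 1) ≤ β / (1 - β * x) * x ^ (i + 1) := by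
  have h1 : ∑ j ∈ Finset.Ico i T, β ^ (j + 1 - i) * x ^ (j + 1) =
      β * x ^ (i + 1) * ∑ k ∈ Finset.range (T - i), (β * x) ^ k := by
    rw [Finset.sum_Ico_eq_sum_range, Finset.mul_sum]
    refine Finset.sum_congr rfl fun k _ => ?_
    rw [show i + k + 1 - i = k + 1 by omega]
    ring
  have h2 : ∑ k ∈ Finset.range (T - i), (β * x) ^ k ≤ (1 - β * x)⁻¹ := by
    rw [← tsum_geometric_of_lt_one (by positivity) hβx]
    exact Summable.sum_le_tsum _ (fun k _ => by positivity)
      (summable_geometric_of_lt_one (by positivity) hβx)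
  rw [h1]
  exact (mul_le_mul_of_nonneg_left h2 (by positivity)).trans_eq (by field_simp)

/-- The test vector `x ^ (j + 1)` reproduces the contraction factor: the subdiagonal gives `K̂ / x`,
the upper triangle a geometric series. The last column fits since `L₁ ≤ L̄`. -/
lemma sum_matA_mul_le (hβ : 0 ≤ β) (hL : L₁ ≤ Lbar L₁ K₁ β) (hL₀ : 0 ≤ Lbar L₁ K₁ β)
    (hK : 0 ≤ K₁) (hρ : 0 < ρ)
    (hKh : 0 ≤ Khat L₁ K₁ β ρ) {x : ℝ} (hx : 0 < x) (hβx : β * x < 1) (T : ℕ) (i : Fin T) :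
    ∑ j, matA L₁ K₁ β ρ T i j * x ^ ((j : ℕ) + 1) ≤
      (Khat L₁ K₁ β ρ / x + (Khat L₁ K₁ β ρ - Kbar L₁ K₁ β ρ) * β / (1 - β * x)) *
        x ^ ((i : ℕ) + 1) := by
  have hb : 0 ≤ K₁ / ρ * Lbar L₁ K₁ β := by positivity
  rw [Khat_sub_Kbar]
  have hentry : ∀ j : Fin T, matA L₁ K₁ β ρ T i j * x ^ ((j : ℕ) + 1) ≤
      (if (i : ℕ) ≤ j then K₁ / ρ * Lbar L₁ K₁ β * (β ^ ((j : ℕ) + 1 - i) * x ^ ((j : ℕ) + 1))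
        else 0) + (if (j : ℕ) + 1 = i then Khat L₁ K₁ β ρ * x ^ (i : ℕ) else 0) := by
    intro j
    simp only [matA, Matrix.of_apply, Fin.le_def]
    have hi := i.2
    split_ifs with h1 h2 h3 h4 <;> try omega
    · rw [add_zero, ← mul_assoc]
      refine mul_le_mul_of_nonneg_right (mul_le_mul_of_nonneg_right ?_ (by positivity))
        (by positivity)
      rw [div_mul_eq_mul_div, mul_comm]
      exact div_le_div_of_nonneg_right (mul_le_mul_of_nonneg_left hL hK) hρ.le
    · rw [add_zero]; exact le_of_eq (by ring)
    · rw [show (i : ℕ) = (j : ℕ) + 1 by omega, Khat, zero_add]; exact le_of_eq (by ring)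
    · simp
  refine (Finset.sum_le_sum fun j _ => hentry j).trans ?_
  rw [Finset.sum_add_distrib]
  have h1 := Fin.sum_univ_eq_sum_range (fun j => if (i : ℕ) ≤ j then
    K₁ / ρ * Lbar L₁ K₁ β * (β ^ (j + 1 - i) * x ^ (j + 1)) else 0) T
  have h2 := Fin.sum_univ_eq_sum_range (fun j => if j + 1 = (i : ℕ) then
    Khat L₁ K₁ β ρ * x ^ (i : ℕ) else 0) T
  rw [h1, h2, ← Finset.sum_filter]
  have h3 : (Finset.range T).filter (fun j => (i : ℕ) ≤ j) = Finset.Ico (i : ℕ) T := by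
    ext j; simp [and_comm]
  rw [h3, ← Finset.mul_sum]
  have h4 := mul_le_mul_of_nonneg_left (sum_Ico_pow_mul_le hβ hx hβx i T) hb
  -- Row `0` has no subdiagonal entry, hence only an inequality.
  have h5 : ∑ j ∈ Finset.range T, (if j + 1 = (i : ℕ) then Khat L₁ K₁ β ρ * x ^ (i : ℕ) else 0) ≤
      Khat L₁ K₁ β ρ * x ^ (i : ℕ) := by
    have h0 : 0 ≤ Khat L₁ K₁ β ρ * x ^ (i : ℕ) := by positivity
    rcases Nat.eq_zero_or_pos (i : ℕ) with hi | hi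
    · rw [hi] at h0 ⊢
      simpa using h0
    · have : ∀ j, (j + 1 = (i : ℕ)) ↔ j = (i : ℕ) - 1 := fun j => by omega
      simp only [this, Finset.sum_ite_eq']
      split_ifs
      · exact le_rfl
      · exact h0
  refine (add_le_add h4 h5).trans_eq ?_
  field_simp
  ring

lemma norm_le_of_mem_spectrum_matA (hβ : 0 ≤ β) (hL₁ : 0 ≤ L₁) (hL : L₁ ≤ Lbar L₁ K₁ β)
    (hK : 0 ≤ K₁) (hρ : 0 < ρ) (hKh : 0 ≤ Khat L₁ K₁ β ρ) {x : ℝ} (hx : 0 < x) (hβx : β * x < 1)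
    (T : ℕ) {z : ℂ} (hz : z ∈ spectrum ℂ ((matA L₁ K₁ β ρ T).map ((↑) : ℝ → ℂ))) :
    ‖z‖ ≤ Khat L₁ K₁ β ρ / x + (Khat L₁ K₁ β ρ - Kbar L₁ K₁ β ρ) * β / (1 - β * x) := by
  have hL₀ := hL₁.trans hL
  refine norm_le_of_mem_spectrum (fun i j => ?_) (w := fun j => x ^ ((j : ℕ) + 1))
    (fun i => by positivity) (sum_matA_mul_le hβ hL hL₀ hK hρ hKh hx hβx T) hz
  simp only [matA, Matrix.of_apply]
  split_ifs
  · positivity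
  · positivity
  · rw [Khat] at hKh; linarith [show Lbar L₁ K₁ β * K₁ / ρ = K₁ / ρ * Lbar L₁ K₁ β by ring]
  · exact le_rfl

lemma specRadA_le (hβ : 0 ≤ β) (hβ₁ : β < 1) (hL₁ : 0 ≤ L₁) (hL : L₁ ≤ Lbar L₁ K₁ β)
    (hK : 0 ≤ K₁) (hρ : 0 < ρ) {x : ℝ} (hx : 0 < x) (hβx : β * x < 1) (T : ℕ) :
    specRadA L₁ K₁ β ρ T ≤
      Khat L₁ K₁ β ρ / x + (Khat L₁ K₁ β ρ - Kbar L₁ K₁ β ρ) * β / (1 - β * x) := by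
  have hL₀ := hL₁.trans hL
  have hKh : 0 ≤ Khat L₁ K₁ β ρ := le_trans (by positivity) (le_Khat hβ hβ₁ hL₀ hK hρ)
  refine ENNReal.toReal_le_of_le_ofReal ?_ (spectralRadius_le_ofReal fun z hz =>
    norm_le_of_mem_spectrum_matA hβ hL₁ hL hK hρ hKh hx hβx T hz)
  rw [Khat_sub_Kbar]
  have : 0 < 1 - β * x := sub_pos.2 hβx
  positivity

/-- The diagonal is positive, so the trace, and with it some eigenvalue, is nonzero. Positivity is
needed to compare reciprocals of spectral radii. -/
lemma specRadA_pos (hβ : 0 < β) (hβ₁ : β < 1) (hL₁ : 0 < L₁) (hL : L₁ ≤ Lbar L₁ K₁ β)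
    (hK : 0 < K₁) (hρ : 0 < ρ) {T : ℕ} (hT : 1 ≤ T) : 0 < specRadA L₁ K₁ β ρ T := by
  have hL₀ := hL₁.trans_le hL
  have hKh : 0 ≤ Khat L₁ K₁ β ρ := le_trans (by positivity) (le_Khat hβ.le hβ₁ hL₀.le hK.le hρ)
  refine spectralRadius_toReal_pos (fun z hz =>
    norm_le_of_mem_spectrum_matA hβ.le hL₁.le hL hK.le hρ hKh one_pos (by simpa using hβ₁) T hz) ?_
  have h1 : 0 < ∑ i, matA L₁ K₁ β ρ T i i := by
    have : Nonempty (Fin T) := ⟨⟨0, hT⟩⟩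
    refine Finset.sum_pos (fun i _ => ?_) Finset.univ_nonempty
    simp only [matA, Matrix.of_apply, le_refl, if_true]
    split_ifs <;> positivity
  have h2 : ((matA L₁ K₁ β ρ T).map ((↑) : ℝ → ℂ)).trace =
      ((∑ i, matA L₁ K₁ β ρ T i i : ℝ) : ℂ) := by
    simp [Matrix.trace]
  rw [h2]
  exact_mod_cast h1.ne'

end HessenbergMatrix

/-! ### Choice of the weight. -/

section Rate

/-- The optimal weight `x`, for which the contraction factor is `β (√K + √b)²`. -/
lemma exists_optimal_weight {K b β ε : ℝ} (hβ₀ : 0 < β) (hε₀ : 0 < ε) (hβ₁ : β < 1)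
    (hK : 0 < K) (hb : 0 < b)
    (hassump : β ^ (1 - ε) < √K / (√K + √b)) (hcontr : √(K * β) + √(b * β) < 1) :
    ∃ x : ℝ, 1 ≤ x ∧ β * x < 1 ∧ K / x + b * β / (1 - β * x) < 1 ∧
      K / ((K / x + b * β / (1 - β * x)) * β) = x ^ 2 ∧ 1 ≤ β ^ ε * x := by
  have hk : 0 < √K := Real.sqrt_pos.2 hK
  have hs : 0 < √b := Real.sqrt_pos.2 hb
  have hk2 : √K ^ 2 = K := Real.sq_sqrt hK.le
  have hs2 : √b ^ 2 = b := Real.sq_sqrt hb.le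
  have hg2 : √β ^ 2 = β := Real.sq_sqrt hβ₀.le
  have hg : 0 < √β := Real.sqrt_pos.2 hβ₀
  rw [Real.sqrt_mul hK.le, Real.sqrt_mul hb.le, ← add_mul] at hcontr
  generalize √K = k at *
  generalize √b = s at *
  generalize √β = g at *
  subst hk2 hs2
  -- This weight is the critical point of the factor in `x`: `k (1 - βx) = s βx`.
  have hx : 0 < k / (β * (k + s)) := by positivity
  have hβx : β * (k / (β * (k + s))) = k / (k + s) := by field_simp
  have h1 : 1 - β * (k / (β * (k + s))) = s / (k + s) := by rw [hβx]; field_simp; ring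
  have hrate : k ^ 2 / (k / (β * (k + s))) + s ^ 2 * β / (1 - β * (k / (β * (k + s)))) =
      β * (k + s) ^ 2 := by
    rw [h1]; field_simp
  have hy : 1 ≤ β ^ ε * (k / (β * (k + s))) := by
    have h2 : β ^ (1 - ε) * β ^ ε = β := by
      rw [← Real.rpow_add hβ₀, sub_add_cancel, Real.rpow_one]
    have h3 : β ≤ k / (k + s) * β ^ ε := by
      conv_lhs => rw [← h2]
      exact mul_le_mul_of_nonneg_right hassump.le (Real.rpow_nonneg hβ₀.le _)
    have h4 : β ^ ε * (k / (β * (k + s))) = k / (k + s) * β ^ ε / β := by field_simp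
    rw [h4, le_div_iff₀ hβ₀, one_mul]
    exact h3
  refine ⟨k / (β * (k + s)), ?_, ?_, ?_, ?_, hy⟩
  · refine hy.trans (mul_le_of_le_one_left hx.le ?_)
    exact Real.rpow_le_one hβ₀.le hβ₁.le hε₀.le
  · rw [hβx, div_lt_one (by positivity)]; linarith
  · rw [hrate, ← hg2, ← mul_pow, mul_comm]
    exact pow_lt_one₀ (by positivity) hcontr two_ne_zero
  · rw [hrate]; field_simp

/-- An admissible weight, also when `b = 0`. -/
lemma exists_weight {K b β ε : ℝ} (hβ₀ : 0 < β) (hε₀ : 0 < ε) (hβ₁ : β < 1)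
    (hK : 0 < K) (hb : 0 ≤ b)
    (hassump : β ^ (1 - ε) < √K / (√K + √b)) (hcontr : √(K * β) + √(b * β) < 1) :
    ∃ x : ℝ, 1 ≤ x ∧ β * x < 1 ∧ K / x + b * β / (1 - β * x) < 1 := by
  have hβε : β < √K / (√K + √b) := by
    refine lt_of_le_of_lt ?_ hassump
    conv_lhs => rw [← Real.rpow_one β]
    exact Real.rpow_le_rpow_of_exponent_ge hβ₀ hβ₁.le (by linarith)
  have hg : 0 < √β := Real.sqrt_pos.2 hβ₀
  have hk : 0 < √K := Real.sqrt_pos.2 hK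
  have hs₀ : 0 < √(K * β) := Real.sqrt_pos.2 (by positivity)
  have hr₀ := Real.sqrt_nonneg (b * β)
  have hβs : β * (√(K * β) + √(b * β)) < √(K * β) := by
    rw [Real.sqrt_mul hK.le, Real.sqrt_mul hb, ← add_mul, ← mul_assoc]
    rw [lt_div_iff₀ (by positivity)] at hβε
    exact mul_lt_mul_of_pos_right hβε hg
  have hs2 : √(K * β) ^ 2 = K * β := Real.sq_sqrt (by positivity)
  have hr2 : √(b * β) ^ 2 = b * β := Real.sq_sqrt (by positivity)
  set s := √(K * β)
  set r := √(b * β)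
  -- After multiplication by `s + r` this combines `β(s + r) < s` with `s + r < 1`.
  have hβr : β + r ≤ 1 := by
    have h1 : (β + r) * (s + r) ≤ 1 * (s + r) := by nlinarith
    exact le_of_mul_le_mul_right h1 (by positivity)
  -- The weight is `y / β`. The maximum with `β` ensures `x ≥ 1`; the two terms of the factor are
  -- then at most `s` and `r`. For `b = 0` the optimal weight would violate `βx < 1`.
  set y := max s β with hy
  have hsy : s ≤ y := le_max_left _ _
  have hβy : β ≤ y := le_max_right _ _
  have hy₁ : y < 1 := max_lt (by linarith) hβ₁
  have hry : r ≤ 1 - y := by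
    have : y ≤ 1 - r := max_le (by linarith) (by linarith)
    linarith
  have hy₀ : 0 < y := hβ₀.trans_le hβy
  have hβx : β * (y / β) = y := by field_simp
  refine ⟨y / β, (one_le_div hβ₀).2 hβy, by rwa [hβx], ?_⟩
  rw [hβx, ← hr2, div_div_eq_mul_div, ← hs2]
  have h1 : s ^ 2 / y ≤ s := by
    rw [div_le_iff₀ hy₀, sq]
    exact mul_le_mul_of_nonneg_left hsy hs₀.le
  have h2 : r ^ 2 / (1 - y) ≤ r := by
    rw [div_le_iff₀ (by linarith), sq]
    exact mul_le_mul_of_nonneg_left hry hr₀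
  linarith

end Rate

/-! ### Equilibria as fixed points, and comparison of the two horizons. -/

namespace RegMFG

variable {X A : Type*} [Fintype X] [Fintype A] {G : RegMFG X A} {L₁ K₁ ρ : ℝ}

lemma Khat_nonneg (h : G.Regular L₁ K₁ ρ) : 0 ≤ Khat L₁ K₁ G.disc ρ := by
  have hl := Lbar_nonneg h.L_nonneg h.disc_mul_lt
  have hρ := h.rho_pos
  have hK := h.K_nonneg
  exact le_trans (by positivity) (le_Khat h.disc_pos.le h.disc_lt_one hl hK hρ)

lemma rate_nonneg (h : G.Regular L₁ K₁ ρ) {x : ℝ} (hx : 0 < x) (hx₁ : G.disc * x < 1) :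
    0 ≤ G.rate L₁ K₁ ρ x := by
  have hl := Lbar_nonneg h.L_nonneg h.disc_mul_lt
  have hρ := h.rho_pos
  have hK := h.K_nonneg
  have hβ := h.disc_pos
  have h2 := Khat_nonneg h
  have h3 : 0 < 1 - G.disc * x := sub_pos.2 hx₁
  rw [rate, Khat_sub_Kbar]
  positivity

variable [Nonempty A]

section InfiniteHorizon

/-- The flow generated by the best responses to the flow `μ`, with values `V`. -/
noncomputable def flowMap (G : RegMFG X A) (V : MFlow X → ℕ → X → ℝ) (μ : MFlow X) : MFlow X
  | 0 => G.init
  | t + 1 => G.nextBest (μ t) (V μ (t + 1))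

variable {V : MFlow X → ℕ → X → ℝ} {B x : ℝ}

lemma tvDist_flowMap_le (h : G.Regular L₁ K₁ ρ)
    (hV : ∀ μ t, V μ t = G.bellman (μ t) (V μ (t + 1))) (hB : ∀ μ t y, |V μ t y| ≤ B)
    (hx : 0 < x) (hx₁ : G.disc * x < 1) {c : ℝ} (hc : 0 ≤ c) {μ ν : MFlow X}
    (he : ∀ t, tvDist (μ t) (ν t) ≤ c * x ^ t) (t : ℕ) :
    tvDist (G.flowMap V μ t) (G.flowMap V ν t) ≤ G.rate L₁ K₁ ρ x * c * x ^ t := by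
  have hr := rate_nonneg h hx hx₁
  cases t with
  | zero =>
    rw [flowMap, flowMap, tvDist_self]
    positivity
  | succ t =>
    -- The estimate is applied with the horizon cut at `t + k + 1`, where the values differ by at
    -- most `2B`; this error vanishes as `k → ∞`.
    have h1 := (((tendsto_pow_atTop_nhds_zero_of_lt_one h.disc_pos.le h.disc_lt_one).comp
      (Filter.tendsto_add_atTop_nat 1)).const_mul (K₁ / (2 * ρ) * (2 * B))).const_add
      (G.rate L₁ K₁ ρ x * c * x ^ (t + 1))
    rw [mul_zero, add_zero] at h1
    refine ge_of_tendsto' h1 fun k => ?_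
    refine tvDist_nextBest_le_rate (n := t + k + 1) h (fun t _ => hV μ t) (fun t _ => hV ν t)
      (fun t _ => value_inf_sub_le h (hV μ) (hB μ) t)
      (fun t _ => value_inf_sub_le h (hV ν) (hB ν) t) (fun y => ?_) hc hx hx₁ (fun t _ => he t) rfl
    have h2 := abs_sub (V μ (t + k + 1) y) (V ν (t + k + 1) y)
    have h3 := hB μ (t + k + 1) y
    have h4 := hB ν (t + k + 1) y
    linarith

lemma exists_flowMap_eq (h : G.Regular L₁ K₁ ρ)
    (hV : ∀ μ t, V μ t = G.bellman (μ t) (V μ (t + 1))) (hB : ∀ μ t y, |V μ t y| ≤ B)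
    (hx : 1 ≤ x) (hx₁ : G.disc * x < 1) (hr : G.rate L₁ K₁ ρ x < 1) :
    ∃ μ : MFlow X, G.flowMap V μ = μ := by
  have hx₀ : 0 < x := one_pos.trans_le hx
  obtain ⟨μ, hμ, -⟩ := exists_fixedPoint_of_weighted_contraction (ι := ℕ) (E := PDist X)
    (d := tvDist) (Φ := G.flowMap V) (w := fun t => x ^ t) (f₀ := fun _ => G.init)
    continuous_tvDist tvDist_self tvDist_comm tvDist_triangle zero_le_two dist_le_two_mul_tvDist
    (rate_nonneg h hx₀ hx₁) hr
    (fun c hc f g hfg t => tvDist_flowMap_le h hV hB hx₀ hx₁ hc hfg t) zero_le_one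
    (fun t => (tvDist_le_one _ _).trans (by rw [one_mul]; exact one_le_pow₀ hx))
  exact ⟨μ, hμ⟩

/-- Since `x ≥ 1`, any two flows have weighted distance at most `1`, and the contraction can be
iterated from there. -/
lemma flowMap_eq_unique (h : G.Regular L₁ K₁ ρ)
    (hV : ∀ μ t, V μ t = G.bellman (μ t) (V μ (t + 1))) (hB : ∀ μ t y, |V μ t y| ≤ B)
    (hx : 1 ≤ x) (hx₁ : G.disc * x < 1) (hr : G.rate L₁ K₁ ρ x < 1) {μ ν : MFlow X}
    (hμ : G.flowMap V μ = μ) (hν : G.flowMap V ν = ν) : μ = ν := by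
  have hx₀ : 0 < x := one_pos.trans_le hx
  have hr₀ := rate_nonneg h hx₀ hx₁
  have h1 : ∀ n t, tvDist (μ t) (ν t) ≤ G.rate L₁ K₁ ρ x ^ n * x ^ t := by
    intro n
    induction n with
    | zero =>
      intro t
      rw [pow_zero, one_mul]
      exact (tvDist_le_one _ _).trans (one_le_pow₀ hx)
    | succ n ih =>
      intro t
      have := tvDist_flowMap_le h hV hB hx₀ hx₁ (pow_nonneg hr₀ n) ih t
      rwa [hμ, hν, ← pow_succ'] at this
  funext t
  have h2 := (tendsto_pow_atTop_nhds_zero_of_lt_one hr₀ hr).mul_const (x ^ t)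
  rw [zero_mul] at h2
  exact eq_of_tvDist_le_zero (ge_of_tendsto' h2 fun n => h1 n t)

lemma IsMFE_ns.gap_le {π : Policy X A} {μ : MFlow X} (hE : G.IsMFE_ns π μ)
    (h : G.Regular L₁ K₁ ρ) {W : ℕ → X → ℝ} (hW : ∀ t, W t = G.bellman (μ t) (W (t + 1)))
    (hB : ∀ t y, |W t y| ≤ B) (t : ℕ) : G.gap μ W G.init π t ≤ 0 :=
  gap_le_of_optimal_inf h hW hB (stdSimplex.zero_le G.init) (stdSimplex.sum_eq_one G.init)
    hE.optimal t

lemma IsMFE_ns.eq_nextBest {π : Policy X A} {μ : MFlow X} (hE : G.IsMFE_ns π μ)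
    (h : G.Regular L₁ K₁ ρ) {W : ℕ → X → ℝ} (hW : ∀ t, W t = G.bellman (μ t) (W (t + 1)))
    (hB : ∀ t y, |W t y| ≤ B) (t : ℕ) : μ (t + 1) = G.nextBest (μ t) (W (t + 1)) :=
  eq_nextBest_of_evol h hE.init_eq (n := t + 1) (fun t _ => hE.evol t) (Nat.lt_succ_self t)
    (hE.gap_le h hW hB t)

lemma IsMFE_ns.flowMap_eq {π : Policy X A} {μ : MFlow X} (hE : G.IsMFE_ns π μ)
    (h : G.Regular L₁ K₁ ρ) (hV : ∀ μ t, V μ t = G.bellman (μ t) (V μ (t + 1)))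
    (hB : ∀ μ t y, |V μ t y| ≤ B) : G.flowMap V μ = μ := by
  funext t
  cases t with
  | zero => exact hE.init_eq.symm
  | succ t => exact (hE.eq_nextBest h (hV μ) (hB μ) t).symm

lemma IsMFE_ns.eq_bestPolicy {π : Policy X A} {μ : MFlow X} (hE : G.IsMFE_ns π μ)
    (h : G.Regular L₁ K₁ ρ) {W : ℕ → X → ℝ} (hW : ∀ t, W t = G.bellman (μ t) (W (t + 1)))
    (hB : ∀ t y, |W t y| ≤ B) {t : ℕ} {y : X} (hy : 0 < μ t y) :
    π t y = G.bestPolicy μ W t y := by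
  rw [← stateLaw_eq_of_evol hE.init_eq (fun t _ => hE.evol t) le_rfl] at hy
  exact eq_bestPolicy_of_gap_le h (stdSimplex.zero_le G.init) (hE.gap_le h hW hB t) hy

lemma isMFE_ns_bestPolicy (h : G.Regular L₁ K₁ ρ)
    (hV : ∀ μ t, V μ t = G.bellman (μ t) (V μ (t + 1)))
    (hB : ∀ μ t y, |V μ t y| ≤ B) {μ : MFlow X} (hμ : G.flowMap V μ = μ) :
    G.IsMFE_ns (G.bestPolicy μ (V μ)) μ where
  init_eq := (congrFun hμ 0).symm
  evol t y := by
    have h1 : μ (t + 1) = G.nextBest (μ t) (V μ (t + 1)) := (congrFun hμ (t + 1)).symm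
    rw [h1]
    refine Finset.sum_congr rfl fun x _ => ?_
    rw [mul_comm, transDist_apply]
    simp [bestPolicy]
  optimal := bestPolicy_optimal h (hV μ) (hB μ) (stdSimplex.zero_le G.init)
    (stdSimplex.sum_eq_one G.init)

/-- Existence and uniqueness of the infinite-horizon equilibrium. -/
theorem existsUnique_isMFE_ns (h : G.Regular L₁ K₁ ρ) (hx : 1 ≤ x) (hx₁ : G.disc * x < 1)
    (hr : G.rate L₁ K₁ ρ x < 1) :
    (∃ (π : Policy X A) (μ : MFlow X), G.IsMFE_ns π μ) ∧
    (∀ (π π' : Policy X A) (μ μ' : MFlow X), G.IsMFE_ns π μ → G.IsMFE_ns π' μ' →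
      μ = μ' ∧ ∀ (t : ℕ) (x : X), 0 < μ t x → π t x = π' t x) ∧
    (∃! e : Policy X A × MFlow X, G.IsMFE_ns e.1 e.2 ∧ G.OptimalFromEverywhere e.1 e.2) := by
  obtain ⟨B, hB₀, hB⟩ := exists_abs_regCost_le h
  choose V hV hVB using exists_value_inf h hB₀ hB
  obtain ⟨μ, hμ⟩ := exists_flowMap_eq h hV hVB hx hx₁ hr
  have huniq : ∀ {π : Policy X A} {ν : MFlow X}, G.IsMFE_ns π ν → ν = μ := fun hE =>
    flowMap_eq_unique h hV hVB hx hx₁ hr (hE.flowMap_eq h hV hVB) hμ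
  refine ⟨⟨_, _, isMFE_ns_bestPolicy h hV hVB hμ⟩, ?_, ?_⟩
  · intro π π' ν ν' hE hE'
    obtain rfl := huniq hE
    obtain rfl := huniq hE'
    refine ⟨rfl, fun t y hy => ?_⟩
    rw [hE.eq_bestPolicy h (hV _) (hVB _) hy, hE'.eq_bestPolicy h (hV _) (hVB _) hy]
  · refine ⟨(G.bestPolicy μ (V μ), μ), ⟨isMFE_ns_bestPolicy h hV hVB hμ,
      optimalFromEverywhere_bestPolicy h (hV μ) (hVB μ)⟩, ?_⟩
    rintro ⟨π, ν⟩ ⟨hE, hO⟩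
    obtain rfl := huniq hE
    exact Prod.ext (eq_bestPolicy_of_optimalFromEverywhere h (hV _) (hVB _) hO) rfl

end InfiniteHorizon

section FiniteHorizon

lemma IsMFE_T.eq_nextBest {π : Policy X A} {μ : MFlow X} {T : ℕ} (hE : G.IsMFE_T T π μ)
    (h : G.Regular L₁ K₁ ρ) {W : ℕ → X → ℝ} (hW : G.BellmanUpTo μ W (T + 1)) (hT : W (T + 1) = 0)
    {t : ℕ} (ht : t < T) : μ (t + 1) = G.nextBest (μ t) (W (t + 1)) :=
  eq_nextBest_of_evol h hE.init_eq hE.evol ht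
    (gap_le_of_optimal_fin h (stdSimplex.zero_le G.init) hW hT hE.optimal ht.le)

/-- The distance between infinite- and finite-horizon equilibria decays like `x ^ (t - T)`. -/
theorem tvDist_isMFE_le (h : G.Regular L₁ K₁ ρ) {x : ℝ} (hx : 1 ≤ x) (hx₁ : G.disc * x < 1)
    (hr : G.rate L₁ K₁ ρ x < 1) :
    ∃ C : ℝ, 0 ≤ C ∧ ∀ (T : ℕ) (π : Policy X A) (μ : MFlow X), G.IsMFE_ns π μ →
      ∀ (πT : Policy X A) (μT : MFlow X), G.IsMFE_T T πT μT →
      ∀ t ≤ T, tvDist (μ t) (μT t) ≤ C / x ^ T * x ^ t := by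
  obtain ⟨B, hB₀, hB⟩ := exists_abs_regCost_le h
  have hx₀ : 0 < x := one_pos.trans_le hx
  have hβ := h.disc_pos
  have hρ := h.rho_pos
  have hK := h.K_nonneg
  have hβ' : 0 < 1 - G.disc := sub_pos.2 h.disc_lt_one
  have hr' : 0 < 1 - G.rate L₁ K₁ ρ x := sub_pos.2 hr
  set D := K₁ / (2 * ρ) * (B / (1 - G.disc)) with hD
  have hD₀ : 0 ≤ D := by positivity
  refine ⟨D / (1 - G.rate L₁ K₁ ρ x), by positivity, fun T π μ hE πT μT hT => ?_⟩
  obtain ⟨V, hV, hVB⟩ := exists_value_inf h hB₀ hB μ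
  -- The objective includes stage `T`, so the terminal value zero sits at time `T + 1`.
  obtain ⟨W, hW₀, hW⟩ := exists_value_fin G μT (T + 1)
  obtain ⟨s, hs, hmax⟩ := Finset.exists_max_image (Finset.range (T + 1))
    (fun t => tvDist (μ t) (μT t) / x ^ t) ⟨0, by simp⟩
  rw [Finset.mem_range] at hs
  set c := tvDist (μ s) (μT s) / x ^ s with hc
  have hc₀ : 0 ≤ c := div_nonneg (tvDist_nonneg _ _) (by positivity)
  have he : ∀ t < T + 1, tvDist (μ t) (μT t) ≤ c * x ^ t := fun t ht =>
    (div_le_iff₀ (by positivity)).1 (hmax t (Finset.mem_range.2 ht))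
  suffices hmain : c ≤ D / (1 - G.rate L₁ K₁ ρ x) / x ^ T from fun t ht =>
    (he t (by omega)).trans (mul_le_mul_of_nonneg_right hmain (by positivity))
  cases s with
  | zero =>
    rw [hc, hE.init_eq, hT.init_eq, tvDist_self, zero_div]
    positivity
  | succ s =>
    have h1 := tvDist_nextBest_le_rate h (fun t _ => hV t) hW
      (fun t _ => value_inf_sub_le h hV hVB t) (fun t ht => value_fin_sub_le h hW hW₀ ht)
      (B := B / (1 - G.disc)) (fun y => by simpa [hW₀] using hVB (T + 1) y) hc₀ hx₀ hx₁ he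
      (k := T - s) (t := s) (by omega)
    rw [← hE.eq_nextBest h hV hVB s, ← hT.eq_nextBest h hW hW₀ (by omega)] at h1
    -- As `βx < 1`, the terminal error `β^(T-s+1)` is at most `x^(s+1) / x^T`; a spare factor `β²`
    -- is dropped.
    have h2 : G.disc ^ (T - s + 1) * x ^ T ≤ x ^ (s + 1) := by
      obtain ⟨j, rfl⟩ : ∃ j, T = s + 1 + j := ⟨T - (s + 1), by omega⟩
      calc G.disc ^ (s + 1 + j - s + 1) * x ^ (s + 1 + j)
          ≤ G.disc ^ j * x ^ (s + 1 + j) := mul_le_mul_of_nonneg_right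
            (pow_le_pow_of_le_one hβ.le h.disc_lt_one.le (by omega)) (by positivity)
        _ = (G.disc * x) ^ j * x ^ (s + 1) := by ring
        _ ≤ 1 * x ^ (s + 1) := mul_le_mul_of_nonneg_right
            (pow_le_one₀ (by positivity) hx₁.le) (by positivity)
        _ = _ := one_mul _
    have h3 : D * G.disc ^ (T - s + 1) ≤ D / x ^ T * x ^ (s + 1) := by
      rw [div_mul_eq_mul_div, le_div_iff₀ (by positivity), mul_assoc]
      exact mul_le_mul_of_nonneg_left h2 hD₀
    have h4 : tvDist (μ (s + 1)) (μT (s + 1)) = c * x ^ (s + 1) := by rw [hc]; field_simp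
    rw [h4] at h1
    -- At the maximizing time this reads `c ≤ rate · c + D / x^T`, which is solved for `c`.
    have h5 : c * x ^ (s + 1) ≤ (G.rate L₁ K₁ ρ x * c + D / x ^ T) * x ^ (s + 1) := by linarith
    have h6 := le_of_mul_le_mul_right h5 (by positivity)
    rw [div_right_comm, le_div_iff₀ hr']
    linarith

end FiniteHorizon

end RegMFG

/-! ### The main theorem. -/

theorem mainTheorem6 {X A : Type*} [Fintype X] [Fintype A] [Nonempty A]
    (G : RegMFG X A) (L₁ K₁ ρ ε : ℝ)
    (hβ₀ : 0 < G.disc) (hβ₁ : G.disc < 1)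
    (hL₁ : 0 ≤ L₁) (hK₁ : 0 ≤ K₁) (hβK : G.disc * K₁ / 2 < 1)
    (hcost : G.CostLipschitz L₁) (hker : G.KernelLipschitz K₁)
    (hρ : 0 < ρ) (hΩ : StronglyConvexL1 G.reg ρ) (hΩc : ContinuousOn G.reg (stdSimplex ℝ A))
    (hε₀ : 0 < ε) (hε₁ : ε < 1)
    (hassump : G.disc ^ (1 - ε) <
      √(Khat L₁ K₁ G.disc ρ) /
        (√(Khat L₁ K₁ G.disc ρ) + √(Khat L₁ K₁ G.disc ρ - Kbar L₁ K₁ G.disc ρ)))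
    (hcontr : √(Khat L₁ K₁ G.disc ρ * G.disc) +
      √((Khat L₁ K₁ G.disc ρ - Kbar L₁ K₁ G.disc ρ) * G.disc) < 1) :
    (∃ (C : ℝ) (T₀ : ℕ), ∀ T ≥ T₀,
      0 < Khat L₁ K₁ G.disc ρ * Real.cos (Real.pi / (T + 1)) ^ 2 - Kbar L₁ K₁ G.disc ρ →
      ∀ (π : Policy X A) (μ : MFlow X), G.IsMFE_ns π μ →
      ∀ (πT : Policy X A) (μT : MFlow X), G.IsMFE_T T πT μT →
      ∀ t : ℕ, 1 ≤ t → t ≤ T →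
        tvDist (μ t) (μT t) ≤
          C * (1 / (t : ℝ) * √(Khat L₁ K₁ G.disc ρ / (specRadA L₁ K₁ G.disc ρ T * G.disc)) ^ t *
            (2 * (T : ℝ) + 1) * G.disc ^ ((T : ℝ) * ε))) ∧
    (∃ (π : Policy X A) (μ : MFlow X), G.IsMFE_ns π μ) ∧
    (∀ (π π' : Policy X A) (μ μ' : MFlow X), G.IsMFE_ns π μ → G.IsMFE_ns π' μ' →
      μ = μ' ∧ ∀ (t : ℕ) (x : X), 0 < μ t x → π t x = π' t x) ∧
    (∃! e : Policy X A × MFlow X, G.IsMFE_ns e.1 e.2 ∧ G.OptimalFromEverywhere e.1 e.2) := by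

  have h : G.Regular L₁ K₁ ρ := ⟨hβ₀, hβ₁, hL₁, hK₁, hβK, hcost, hker, hρ, hΩ, hΩc⟩
  have hl₀ := Lbar_nonneg hL₁ hβK
  have hl : L₁ ≤ Lbar L₁ K₁ G.disc := by
    rw [← Lbar_eq hβK]
    exact le_add_of_nonneg_right (by positivity)
  have hK : 0 < Khat L₁ K₁ G.disc ρ := by
    refine (RegMFG.Khat_nonneg h).lt_of_ne fun h0 => ?_
    rw [← h0, Real.sqrt_zero, zero_div] at hassump
    exact absurd hassump (not_lt.2 (Real.rpow_nonneg hβ₀.le _))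
  have hb₀ : 0 ≤ Khat L₁ K₁ G.disc ρ - Kbar L₁ K₁ G.disc ρ := by
    rw [Khat_sub_Kbar]; positivity
  constructor
  · rcases hb₀.eq_or_lt with hb | hb
    -- If `K̂ = K̄`, the cosine condition fails for every `T`.
    · refine ⟨0, 0, fun T _ hcos => ?_⟩
      have h1 := mul_le_of_le_one_right hK.le (Real.cos_sq_le_one (Real.pi / (T + 1)))
      linarith
    obtain ⟨x, hx, hx₁, hr, hsq, hxε⟩ :=
      exists_optimal_weight hβ₀ hε₀ hβ₁ hK hb hassump hcontr
    have hx₀ : 0 < x := one_pos.trans_le hx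
    have hbpos := hb
    rw [Khat_sub_Kbar] at hbpos
    have hK₁' : 0 < K₁ := hK₁.lt_of_ne fun h0 => by simp [← h0] at hbpos
    have hL₁' : 0 < L₁ := hL₁.lt_of_ne fun h0 => by simp [← h0, Lbar] at hbpos
    obtain ⟨C, hC, hmain⟩ := RegMFG.tvDist_isMFE_le h hx hx₁ hr
    refine ⟨C, 0, fun T _ _ π μ hE πT μT hT t ht₁ htT => (hmain T π μ hE πT μT hT t htT).trans ?_⟩
    have hspec := specRadA_le hβ₀.le hβ₁ hL₁ hl hK₁ hρ hx₀ hx₁ T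
    have hspec₀ := specRadA_pos hβ₀ hβ₁ hL₁' hl hK₁' hρ (ht₁.trans htT)
    have hroot : x ≤ √(Khat L₁ K₁ G.disc ρ / (specRadA L₁ K₁ G.disc ρ T * G.disc)) := by
      refine Real.le_sqrt_of_sq_le ?_
      rw [← hsq]
      exact div_le_div_of_nonneg_left hK.le (mul_pos hspec₀ hβ₀)
        (mul_le_mul_of_nonneg_right hspec hβ₀.le)
    have hpow : 1 / x ^ T ≤ G.disc ^ ((T : ℝ) * ε) := by
      rw [div_le_iff₀ (by positivity), mul_comm (T : ℝ) ε, Real.rpow_mul hβ₀.le,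
        Real.rpow_natCast, ← mul_pow]
      exact one_le_pow₀ hxε
    have ht₀ : (0 : ℝ) < t := by exact_mod_cast ht₁
    -- The estimate already holds without this factor, which is at least one for `t ≤ T`.
    have hslack : 1 ≤ 1 / (t : ℝ) * (2 * (T : ℝ) + 1) := by
      rw [one_div_mul_eq_div, le_div_iff₀ ht₀]
      have : (t : ℝ) ≤ T := by exact_mod_cast htT
      linarith
    have hpow₀ : 0 ≤ G.disc ^ ((T : ℝ) * ε) := Real.rpow_nonneg hβ₀.le _
    calc C / x ^ T * x ^ t = C * (1 * (x ^ t * (1 / x ^ T))) := by ring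
      _ ≤ C * ((1 / (t : ℝ) * (2 * (T : ℝ) + 1)) *
          (√(Khat L₁ K₁ G.disc ρ / (specRadA L₁ K₁ G.disc ρ T * G.disc)) ^ t *
            G.disc ^ ((T : ℝ) * ε))) := by gcongr
      _ = _ := by ring
  · obtain ⟨x, hx, hx₁, hr⟩ := exists_weight hβ₀ hε₀ hβ₁ hK hb₀ hassump hcontr
    exact RegMFG.existsUnique_isMFE_ns h hx hx₁ hr
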